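/- Let $\mathcal K$ be a complex Hilbert space with an antilinear involution $\Gamma=\Gamma^*=\Gamma^{-1}$, and let $\mathcal L_\varphi,\mathcal L_\pi\subset\mathcal K$ be closed complex subspaces that are invariant under $\Gamma$, with orthogonal projections $E_\varphi,E_\pi$. Put $\mathcal L=(1+\Gamma)\mathcal L_\varphi+(1-\Gamma)\mathcal L_\pi$, a real linear subspace of $\mathcal K$. Let $\mathcal H$ be the antisymmetric Fock space over $\mathcal K$ with vacuum vector $\Omega$ and creation and annihilation operators $a^*(\psi)$, $a(\psi)=a^*(\psi)^*$ satisfying the canonical anticommutation relations; let $\phi(\psi)=a^*(\psi)+a(\psi)$, and let $\mathcal A(\mathcal L)=\{\phi(\psi):\psi\in\mathcal L\}''$ be the von Neumann algebra generated by the fields $\phi(\psi)$, $\psi\in\mathcal L$. Let $X$ be a densely defined, possibly unbounded, strictly positive operator on $\mathcal K$ (that is, $\langle\psi,X\psi\rangle>0$ for all nonzero $\psi\in\operatorname{dom}X$) which commutes with $\Gamma$. Denote its second quantization, the closed operator $\bigoplus_{n\ge0}X^{\otimes n}$ on $\mathcal H$, by $X$ as well, and assume that $\mathcal A(\mathcal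 L)\Omega$ is contained in the domain of this operator. A linear map $\Xi:\mathcal A\to\mathcal H$ between Banach spaces is called nuclear if there are $\rho_k\in\mathcal A^*$ and $\Psi_k\in\mathcal H$, $k\in\mathbb N$, with $\Xi(A)=\sum_k\rho_k(A)\Psi_k$ for all $A\in\mathcal A$ and $\sum_k\|\rho_k\|\|\Psi_k\|<\infty$; its nuclear norm $\|\Xi\|_1$ is the infimum of $\sum_k\|\rho_k\|\|\Psi_k\|$ over all such representations. For a trace class operator $T$ on $\mathcal K$ let $\|T\|_1=\operatorname{Tr}|T|$, and for a positive trace class operator $S$ with eigenvalues $s_j$, repeated according to multiplicity, let $\det(1+S)=\prod_j(1+s_j)$. Assume that $E_\varphi X$ and $E_\pi X$ extend to trace class operators $T_\varphi$ and $T_\pi$ on $\mathcal K$. Then the map $$\Xi_{\mathcal L}:\mathcal A(\mathcal L)\to\mathcal H,\qquad \Xi_{\mathcal L}(A)=XA\Omega,$$ is nuclear, the positive operator $T=(|T_\varphi|^2+|T_\pi|^2)^{1/2}$ is trace class, and $$\|\Xi_{\mathcal L}\|_1\;\le\;\det(1+2T)\;\le\;e^{2\|T_\varphi\|_1}\,e^{2\|T_\pi\|_1}.$$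 -/

import Mathlib

open scoped InnerProductSpace ComplexConjugate ComplexOrder

noncomputable section

namespace FermiFock

universe u

section Algebraic

variable {K : Type u} [NormedAddCommGroup K] [InnerProductSpace ℂ K]

/-- Annihilation by `v` on the exterior algebra over `K`: the contraction with `⟪v, ·⟫`, i.e. the
antiderivation with `annihAlg v (ι w * x) = ⟪v, w⟫ • x - ι w * annihAlg v x` and
`annihAlg v 1 = 0`. -/
def annihAlg (v : K) : ExteriorAlgebra ℂ K →ₗ[ℂ] ExteriorAlgebra ℂ K :=
  CliffordAlgebra.contractLeft (Q := (0 : QuadraticForm ℂ K)) (innerₛₗ ℂ v)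

/-- Creation by `v` on the exterior algebra: left multiplication `x ↦ v ∧ x`. -/
def createAlg (v : K) : ExteriorAlgebra ℂ K →ₗ[ℂ] ExteriorAlgebra ℂ K :=
  LinearMap.mulLeft ℂ (ExteriorAlgebra.ι ℂ v)

theorem annihAlg_ι_mul (v w : K) (x : ExteriorAlgebra ℂ K) :
    annihAlg v (ExteriorAlgebra.ι ℂ w * x)
      = ⟪v, w⟫_ℂ • x - ExteriorAlgebra.ι ℂ w * annihAlg v x :=
  CliffordAlgebra.contractLeft_ι_mul (Q := (0 : QuadraticForm ℂ K)) _ w x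

theorem annihAlg_algebraMap (v : K) (c : ℂ) :
    annihAlg v (algebraMap ℂ (ExteriorAlgebra ℂ K) c) = 0 :=
  CliffordAlgebra.contractLeft_algebraMap (Q := (0 : QuadraticForm ℂ K)) _ c

theorem annihAlg_annihAlg (v : K) (x : ExteriorAlgebra ℂ K) : annihAlg v (annihAlg v x) = 0 :=
  CliffordAlgebra.contractLeft_contractLeft (Q := (0 : QuadraticForm ℂ K)) _ x

theorem annihAlg_smul (c : ℂ) (v : K) : annihAlg (c • v) = conj c • annihAlg v := by
  simp [annihAlg]

theorem annihAlg_add (v w : K) : annihAlg (v + w) = annihAlg v + annihAlg w := by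
  simp [annihAlg]

/-- Transpose of annihilation on antilinear functionals; it is complex linear in `v`. -/
def annihTranspose :
    K →ₗ[ℂ] Module.End ℂ (ExteriorAlgebra ℂ K →ₗ⋆[ℂ] ℂ) where
  toFun v :=
    { toFun := fun f => f.comp (annihAlg v)
      map_add' := fun _ _ => rfl
      map_smul' := fun _ _ => rfl }
  map_add' v w := by ext f x; simp [annihAlg_add]
  map_smul' c v := by ext f x; simp [annihAlg_smul]

/-- The antilinear functional that takes the conjugate of the degree zero component. -/
def vacFunctional : ExteriorAlgebra ℂ K →ₗ⋆[ℂ] ℂ where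
  toFun y := conj (ExteriorAlgebra.algebraMapInv y)
  map_add' _ _ := by simp
  map_smul' _ _ := by simp

/-- The functional `y ↦ ⟪y, x⟫` on the exterior algebra, determined by
`gramForm 1 = vacFunctional` and `gramForm (ι v * x) y = gramForm x (annihAlg v y)`. -/
def gramForm (x : ExteriorAlgebra ℂ K) : ExteriorAlgebra ℂ K →ₗ⋆[ℂ] ℂ :=
  ExteriorAlgebra.lift ℂ ⟨annihTranspose, fun v => by
    ext f x
    simp [annihTranspose, annihAlg_annihAlg]⟩ x vacFunctional

theorem gramForm_add (x x' y : ExteriorAlgebra ℂ K) :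
    gramForm (x + x') y = gramForm x y + gramForm x' y := by
  simp [gramForm]

theorem gramForm_smul (c : ℂ) (x y : ExteriorAlgebra ℂ K) :
    gramForm (c • x) y = c * gramForm x y := by
  simp [gramForm]

theorem gramForm_algebraMap (c : ℂ) (y : ExteriorAlgebra ℂ K) :
    gramForm (algebraMap ℂ _ c) y = c * conj (ExteriorAlgebra.algebraMapInv y) := by
  simp [gramForm, Algebra.algebraMap_eq_smul_one, vacFunctional]

theorem gramForm_ι_mul (v : K) (x y : ExteriorAlgebra ℂ K) :
    gramForm (ExteriorAlgebra.ι ℂ v * x) y = gramForm x (annihAlg v y) := by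
  simp only [gramForm, map_mul, ExteriorAlgebra.lift_ι_apply]
  rfl

theorem gramForm_mul_right (v : K) (x : ExteriorAlgebra ℂ K) :
    ∀ y, gramForm x (ExteriorAlgebra.ι ℂ v * y) = gramForm (annihAlg v x) y := by
  induction x using CliffordAlgebra.left_induction with
  | algebraMap c =>
    intro y
    have h := gramForm_algebraMap (K := K) c (ExteriorAlgebra.ι ℂ v * y)
    have h2 := annihAlg_algebraMap (K := K) v c
    change gramForm (algebraMap ℂ (ExteriorAlgebra ℂ K) c) _
      = gramForm (annihAlg v (algebraMap ℂ (ExteriorAlgebra ℂ K) c)) y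
    rw [h, h2]
    simp [gramForm, ExteriorAlgebra.algebraMapInv]
  | add x x' hx hx' =>
    intro y
    rw [gramForm_add, map_add, gramForm_add, hx, hx']
  | ι_mul x u hx =>
    intro y
    change gramForm (ExteriorAlgebra.ι ℂ u * x) _ = gramForm (annihAlg v (ExteriorAlgebra.ι ℂ u * x)) y
    rw [gramForm_ι_mul, annihAlg_ι_mul, annihAlg_ι_mul, map_sub, hx, sub_eq_add_neg, sub_eq_add_neg,
      gramForm_add, ← neg_one_smul ℂ (ExteriorAlgebra.ι ℂ u * _), gramForm_smul, gramForm_smul,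
      gramForm_ι_mul]
    simp

theorem gramForm_conj (x : ExteriorAlgebra ℂ K) : ∀ y, conj (gramForm y x) = gramForm x y := by
  induction x using CliffordAlgebra.left_induction with
  | algebraMap c =>
    intro y
    change conj (gramForm y (algebraMap ℂ (ExteriorAlgebra ℂ K) c))
      = gramForm (algebraMap ℂ (ExteriorAlgebra ℂ K) c) y
    rw [gramForm_algebraMap]
    induction y using CliffordAlgebra.left_induction with
    | algebraMap d =>
      change conj (gramForm (algebraMap ℂ (ExteriorAlgebra ℂ K) d) _)
        = c * conj (ExteriorAlgebra.algebraMapInv (algebraMap ℂ (ExteriorAlgebra ℂ K) d))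
      rw [gramForm_algebraMap]
      simp [mul_comm]
    | add y y' hy hy' => simp only [gramForm_add, map_add, hy, hy', mul_add]
    | ι_mul y u hy =>
      change conj (gramForm (ExteriorAlgebra.ι ℂ u * y) _)
        = c * conj (ExteriorAlgebra.algebraMapInv (ExteriorAlgebra.ι ℂ u * y))
      rw [gramForm_ι_mul, annihAlg_algebraMap]
      simp [ExteriorAlgebra.algebraMapInv]
  | add x x' hx hx' =>
    intro y
    rw [gramForm_add, map_add, map_add, hx, hx']
  | ι_mul x u hx =>
    intro y
    change conj (gramForm y (ExteriorAlgebra.ι ℂ u * x)) = gramForm (ExteriorAlgebra.ι ℂ u * x) y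
    rw [gramForm_mul_right, gramForm_ι_mul, hx]

theorem annihAlg_map_eq_zero (V : Submodule ℂ K) (e : K) (he : ∀ v ∈ V, ⟪e, v⟫_ℂ = 0)
    (z : ExteriorAlgebra ℂ V) : annihAlg e (ExteriorAlgebra.map V.subtype z) = 0 := by
  induction z using CliffordAlgebra.left_induction with
  | algebraMap c =>
    change annihAlg e (ExteriorAlgebra.map V.subtype (algebraMap ℂ (ExteriorAlgebra ℂ V) c)) = 0
    rw [AlgHom.commutes, annihAlg_algebraMap]
  | add x y hx hy => rw [map_add, map_add, hx, hy, add_zero]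
  | ι_mul x u hx =>
    change annihAlg e (ExteriorAlgebra.map V.subtype (ExteriorAlgebra.ι ℂ u * x)) = 0
    rw [map_mul, ExteriorAlgebra.map_apply_ι, annihAlg_ι_mul, hx]
    simp [he u u.2]

theorem exists_decomp (s : Set K) (e : K) (z : ExteriorAlgebra ℂ (Submodule.span ℂ (insert e s))) :
    ∃ a b : ExteriorAlgebra ℂ (Submodule.span ℂ s),
      ExteriorAlgebra.map (Submodule.span ℂ (insert e s)).subtype z
        = ExteriorAlgebra.map (Submodule.span ℂ s).subtype a
          + ExteriorAlgebra.ι ℂ e * ExteriorAlgebra.map (Submodule.span ℂ s).subtype b := by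
  induction z using CliffordAlgebra.left_induction with
  | algebraMap c =>
    refine ⟨algebraMap ℂ _ c, 0, ?_⟩
    change ExteriorAlgebra.map _ (algebraMap ℂ (ExteriorAlgebra ℂ _) c) = _
    simp
  | add x y hx hy =>
    obtain ⟨a, b, h⟩ := hx
    obtain ⟨a', b', h'⟩ := hy
    refine ⟨a + a', b + b', ?_⟩
    rw [map_add, h, h', map_add, map_add, mul_add]
    abel
  | ι_mul x u hx =>
    obtain ⟨a, b, h⟩ := hx
    obtain ⟨c, v, hv, hu⟩ := Submodule.mem_span_insert.1 u.2
    refine ⟨ExteriorAlgebra.ι ℂ ⟨v, hv⟩ * a, c • a - ExteriorAlgebra.ι ℂ ⟨v, hv⟩ * b, ?_⟩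
    change ExteriorAlgebra.map _ (ExteriorAlgebra.ι ℂ u * x) = _
    have hanti : ExteriorAlgebra.ι ℂ v * ExteriorAlgebra.ι ℂ e
        = - (ExteriorAlgebra.ι ℂ e * ExteriorAlgebra.ι ℂ v) :=
      eq_neg_of_add_eq_zero_left (ExteriorAlgebra.ι_add_mul_swap v e)
    have hsq : ExteriorAlgebra.ι ℂ e * ExteriorAlgebra.ι ℂ e = 0 := ExteriorAlgebra.ι_sq_zero e
    simp only [map_mul, ExteriorAlgebra.map_apply_ι, h, Submodule.subtype_apply, hu, map_add,
      map_smul, map_sub, mul_add, add_mul, mul_sub, ← mul_assoc, hanti, smul_mul_assoc, hsq,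
      mul_smul_comm, neg_mul, zero_mul, smul_zero]
    abel

theorem gramForm_self_nonneg_of_orthonormal (s : Finset K) :
    Orthonormal ℂ ((↑) : s → K) → ∀ z : ExteriorAlgebra ℂ (Submodule.span ℂ (s : Set K)),
      0 ≤ gramForm (ExteriorAlgebra.map (Submodule.span ℂ (s : Set K)).subtype z)
        (ExteriorAlgebra.map (Submodule.span ℂ (s : Set K)).subtype z) := by
  classical
  induction s using Finset.induction_on with
  | empty =>
    intro _ z
    have hz : ∃ c : ℂ, ExteriorAlgebra.map (Submodule.span ℂ ((∅ : Finset K) : Set K)).subtype z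
        = algebraMap ℂ _ c := by
      induction z using CliffordAlgebra.left_induction with
      | algebraMap c => exact ⟨c, AlgHom.commutes _ c⟩
      | add x y hx hy =>
        obtain ⟨a, ha⟩ := hx
        obtain ⟨b, hb⟩ := hy
        exact ⟨a + b, by rw [map_add, ha, hb, map_add]⟩
      | ι_mul x u hx =>
        refine ⟨0, ?_⟩
        have hu : (u : K) = 0 := by simpa using u.2
        change ExteriorAlgebra.map _ (ExteriorAlgebra.ι ℂ u * x) = _
        rw [map_mul, ExteriorAlgebra.map_apply_ι, Submodule.subtype_apply, hu]
        simp
    obtain ⟨c, hc⟩ := hz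
    rw [hc, gramForm_algebraMap, ExteriorAlgebra.algebraMap_leftInverse]
    rw [Complex.mul_conj]
    exact_mod_cast Complex.normSq_nonneg c
  | insert e s hes ih =>
    intro hon z
    have hon' : Orthonormal ℂ ((↑) : s → K) :=
      hon.comp (fun x : s => (⟨x, Finset.mem_insert_of_mem x.2⟩ : (insert e s : Finset K)))
        (fun x y h => Subtype.ext (Subtype.mk.inj h))
    have he : ∀ v ∈ Submodule.span ℂ (s : Set K), ⟪e, v⟫_ℂ = 0 := by
      intro v hv
      induction hv using Submodule.span_induction with
      | mem x hx =>
        exact hon.2 (i := ⟨e, Finset.mem_insert_self e s⟩)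
          (j := ⟨x, Finset.mem_insert_of_mem hx⟩)
          (fun h => hes (by rw [Subtype.mk.injEq] at h; rw [h]; exact hx))
      | zero => simp
      | add x y _ _ hx hy => rw [inner_add_right, hx, hy, add_zero]
      | smul c x _ hx => rw [inner_smul_right, hx, mul_zero]
    have hee : ⟪e, e⟫_ℂ = 1 := by
      have := hon.1 ⟨e, Finset.mem_insert_self e s⟩
      rw [inner_self_eq_norm_sq_to_K]
      simp only at this
      rw [this]
      simp
    have hins : ((insert e s : Finset K) : Set K) = insert e (s : Set K) := Finset.coe_insert e s
    have hdec : ∃ a b : ExteriorAlgebra ℂ (Submodule.span ℂ (s : Set K)),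
        ExteriorAlgebra.map (Submodule.span ℂ ((insert e s : Finset K) : Set K)).subtype z
        = ExteriorAlgebra.map (Submodule.span ℂ (s : Set K)).subtype a
          + ExteriorAlgebra.ι ℂ e
            * ExteriorAlgebra.map (Submodule.span ℂ (s : Set K)).subtype b := by
      revert z
      rw [hins]
      exact exists_decomp (s : Set K) e
    obtain ⟨a, b, hab⟩ := hdec
    rw [hab, gramForm_add, map_add, map_add, gramForm_ι_mul, gramForm_ι_mul, gramForm_mul_right,
      annihAlg_ι_mul, annihAlg_map_eq_zero _ e he, annihAlg_map_eq_zero _ e he, hee]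
    have h0 : gramForm (0 : ExteriorAlgebra ℂ K)
        (ExteriorAlgebra.map (Submodule.span ℂ (s : Set K)).subtype b) = 0 := by
      simp [gramForm]
    rw [h0]
    simpa using add_nonneg (ih hon' a) (ih hon' b)

theorem exists_finiteDimensional (x : ExteriorAlgebra ℂ K) :
    ∃ V : Submodule ℂ K, FiniteDimensional ℂ V ∧
      ∃ z : ExteriorAlgebra ℂ V, ExteriorAlgebra.map V.subtype z = x := by
  have mono : ∀ (V W : Submodule ℂ K) (_ : V ≤ W) (z : ExteriorAlgebra ℂ V),
      ∃ z' : ExteriorAlgebra ℂ W, ExteriorAlgebra.map W.subtype z'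
        = ExteriorAlgebra.map V.subtype z := by
    intro V W h z
    refine ⟨ExteriorAlgebra.map (Submodule.inclusion h) z, ?_⟩
    rw [← AlgHom.comp_apply, ExteriorAlgebra.map_comp_map, Submodule.subtype_comp_inclusion]
  induction x using CliffordAlgebra.left_induction with
  | algebraMap c => exact ⟨⊥, inferInstance, algebraMap ℂ _ c, AlgHom.commutes _ c⟩
  | add x y hx hy =>
    obtain ⟨V, hV, z, rfl⟩ := hx
    obtain ⟨W, hW, w, rfl⟩ := hy
    obtain ⟨z', hz⟩ := mono V (V ⊔ W) le_sup_left z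
    obtain ⟨w', hw⟩ := mono W (V ⊔ W) le_sup_right w
    exact ⟨V ⊔ W, inferInstance, z' + w', by rw [map_add, hz, hw]⟩
  | ι_mul x u hx =>
    obtain ⟨V, hV, z, rfl⟩ := hx
    obtain ⟨z', hz⟩ := mono V (V ⊔ ℂ ∙ u) le_sup_left z
    refine ⟨V ⊔ ℂ ∙ u, inferInstance, ExteriorAlgebra.ι ℂ
      ⟨u, Submodule.mem_sup_right (Submodule.mem_span_singleton_self u)⟩ * z', ?_⟩
    rw [map_mul, hz, ExteriorAlgebra.map_apply_ι]
    rfl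

theorem gramForm_self_nonneg (x : ExteriorAlgebra ℂ K) : 0 ≤ gramForm x x := by
  classical
  obtain ⟨V, hV, z, rfl⟩ := exists_finiteDimensional x
  obtain ⟨s, b, hb⟩ := exists_orthonormalBasis ℂ V
  have hspan : Submodule.span ℂ ((s.map ⟨((↑) : V → K), Subtype.val_injective⟩ : Finset K) : Set K)
      = V := by
    have h1 := b.toBasis.span_eq
    rw [OrthonormalBasis.coe_toBasis, hb, Subtype.range_coe] at h1
    have h2 := congrArg (Submodule.map V.subtype) h1
    rw [Submodule.map_span, Submodule.map_top, Submodule.range_subtype] at h2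
    simpa using h2
  have hon : Orthonormal ℂ
      ((↑) : (s.map ⟨((↑) : V → K), Subtype.val_injective⟩ : Finset K) → K) := by
    have h1 : Orthonormal ℂ (fun i : s => ((i : V) : K)) := by
      have := b.orthonormal.comp_linearIsometry V.subtypeₗᵢ
      rw [hb] at this
      exact this
    let f : (s.map ⟨((↑) : V → K), Subtype.val_injective⟩ : Finset K) → s := fun x =>
      ⟨⟨x, by obtain ⟨y, _, hy⟩ := Finset.mem_map.1 x.2; rw [← hy]; exact y.2⟩, by
        obtain ⟨y, hy1, hy⟩ := Finset.mem_map.1 x.2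
        have hxy : (⟨x, by rw [← hy]; exact y.2⟩ : V) = y := Subtype.ext hy.symm
        rw [hxy]
        exact hy1⟩
    exact h1.comp f (fun x y h => by
      have := congrArg (fun i : s => ((i : V) : K)) h
      exact Subtype.ext this)
  have key := gramForm_self_nonneg_of_orthonormal _ hon
  rw [hspan] at key
  exact key z

/-- The inner product on the exterior algebra: it is determined by `⟪1, 1⟫ = 1`, `⟪1, ι v * y⟫ = 0`
and by left multiplication with `ι v` being adjoint to `annihAlg v`. Components of different degree
are orthogonal and `⟪v₁ ∧ ⋯ ∧ vₙ, w₁ ∧ ⋯ ∧ wₙ⟫ = det ⟪vᵢ, wⱼ⟫`. -/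
instance instCore : PreInnerProductSpace.Core ℂ (ExteriorAlgebra ℂ K) where
  inner x y := gramForm y x
  conj_inner_symm x y := gramForm_conj y x
  re_inner_nonneg x := (Complex.le_def.1 (gramForm_self_nonneg x)).1
  add_left x y z := by simp
  smul_left x y c := by simp

instance instSeminormed : SeminormedAddCommGroup (ExteriorAlgebra ℂ K) :=
  InnerProductSpace.Core.toSeminormedAddCommGroup (𝕜 := ℂ)

instance instInner : InnerProductSpace ℂ (ExteriorAlgebra ℂ K) :=
  InnerProductSpace.ofCore _

theorem inner_ι_mul_left (v : K) (x y : ExteriorAlgebra ℂ K) :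
    ⟪ExteriorAlgebra.ι ℂ v * x, y⟫_ℂ = ⟪x, annihAlg v y⟫_ℂ :=
  gramForm_mul_right v y x

theorem norm_createAlg_le (v : K) (x : ExteriorAlgebra ℂ K) :
    ‖createAlg v x‖ ≤ ‖v‖ * ‖x‖ := by
  have h1 : ⟪createAlg v x, createAlg v x⟫_ℂ
      = ⟪v, v⟫_ℂ * ⟪x, x⟫_ℂ - ⟪annihAlg v x, annihAlg v x⟫_ℂ := by
    simp only [createAlg, LinearMap.mulLeft_apply]
    rw [inner_ι_mul_left, annihAlg_ι_mul, inner_sub_right, inner_smul_right]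
    congr 1
    rw [← inner_conj_symm, inner_ι_mul_left, inner_conj_symm]
  have h2 : ‖createAlg v x‖ ^ 2 = ‖v‖ ^ 2 * ‖x‖ ^ 2 - ‖annihAlg v x‖ ^ 2 := by
    simp only [inner_self_eq_norm_sq_to_K] at h1
    exact_mod_cast h1
  refine (sq_le_sq₀ (norm_nonneg _) (by positivity)).1 ?_
  nlinarith [sq_nonneg ‖annihAlg v x‖]

end Algebraic

section Fock

variable (K : Type u) [NormedAddCommGroup K] [InnerProductSpace ℂ K]

/-- The antisymmetric (fermionic) Fock space over `K`: the Hilbert space completion of the exterior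
algebra over `K`. -/
def Fock : Type u := UniformSpace.Completion (ExteriorAlgebra ℂ K)

instance instFockNormed : NormedAddCommGroup (Fock K) :=
  inferInstanceAs (NormedAddCommGroup (UniformSpace.Completion (ExteriorAlgebra ℂ K)))

instance instFockInner : InnerProductSpace ℂ (Fock K) :=
  inferInstanceAs (InnerProductSpace ℂ (UniformSpace.Completion (ExteriorAlgebra ℂ K)))

instance instFockComplete : CompleteSpace (Fock K) :=
  inferInstanceAs (CompleteSpace (UniformSpace.Completion (ExteriorAlgebra ℂ K)))

variable {K}

/-- The canonical isometric map of the exterior algebra onto a dense subspace of Fock space. -/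
def toFock : ExteriorAlgebra ℂ K →ₗᵢ[ℂ] Fock K :=
  UniformSpace.Completion.toComplₗᵢ (𝕜 := ℂ) (E := ExteriorAlgebra ℂ K)

theorem denseRange_toFock : DenseRange (toFock (K := K)) :=
  UniformSpace.Completion.denseRange_coe (α := ExteriorAlgebra ℂ K)

variable (K) in
/-- The vacuum vector. -/
def vacuum : Fock K := toFock 1

/-- The creation operator `a*(ψ)`, complex linear in `ψ`: the continuous extension of `x ↦ ψ ∧ x`. -/
def creation (ψ : K) : Fock K →L[ℂ] Fock K :=
  ContinuousLinearMap.completion ((createAlg ψ).mkContinuous ‖ψ‖ (norm_createAlg_le ψ))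

theorem creation_toFock (ψ : K) (x : ExteriorAlgebra ℂ K) :
    creation ψ (toFock x) = toFock (ExteriorAlgebra.ι ℂ ψ * x) :=
  ContinuousLinearMap.completion_apply_coe
    ((createAlg ψ).mkContinuous ‖ψ‖ (norm_createAlg_le ψ)) x

attribute [irreducible] Fock instFockNormed instFockInner toFock creation

/-- The annihilation operator `a(ψ)`, the adjoint of `a*(ψ)`. -/
def annihilation (ψ : K) : Fock K →L[ℂ] Fock K :=
  ContinuousLinearMap.adjoint (creation ψ)

/-- The fermionic field operator `φ(ψ) = a*(ψ) + a(ψ)`. -/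
def field (ψ : K) : Fock K →L[ℂ] Fock K := creation ψ + annihilation ψ

theorem star_field (ψ : K) : star (field ψ) = field ψ := by
  rw [ContinuousLinearMap.star_eq_adjoint]
  simp [field, annihilation, add_comm]

/-- The von Neumann algebra `{φ(ψ) : ψ ∈ L}''` generated by the field operators. -/
def fieldAlgebra (L : Submodule ℝ K) : VonNeumannAlgebra (Fock K) where
  toStarSubalgebra := StarSubalgebra.centralizer ℂ
    (StarSubalgebra.centralizer ℂ (field '' (L : Set K)) : Set (Fock K →L[ℂ] Fock K))
  centralizer_centralizer' := by simp

theorem coe_fieldAlgebra (L : Submodule ℝ K) :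
    (fieldAlgebra L : Set (Fock K →L[ℂ] Fock K))
      = Set.centralizer (Set.centralizer (field '' (L : Set K))) := by
  have hstar : star (field '' (L : Set K)) = field '' (L : Set K) := by
    ext A
    simp only [Set.mem_star, Set.mem_image]
    constructor
    · rintro ⟨ψ, hψ, h⟩
      exact ⟨ψ, hψ, by rw [← star_field, h, star_star]⟩
    · rintro ⟨ψ, hψ, h⟩
      exact ⟨ψ, hψ, by rw [← star_field, h]⟩
  have h1 : (StarSubalgebra.centralizer ℂ (field '' (L : Set K)) : Set (Fock K →L[ℂ] Fock K))
      = Set.centralizer (field '' (L : Set K)) := by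
    rw [StarSubalgebra.coe_centralizer, hstar, Set.union_self]
  have h2 : (fieldAlgebra L : Set (Fock K →L[ℂ] Fock K))
      = (StarSubalgebra.centralizer ℂ (StarSubalgebra.centralizer ℂ (field '' (L : Set K)) :
          Set (Fock K →L[ℂ] Fock K)) : Set (Fock K →L[ℂ] Fock K)) := rfl
  have h3 : star (StarSubalgebra.centralizer ℂ (field '' (L : Set K)) :
      Set (Fock K →L[ℂ] Fock K)) = StarSubalgebra.centralizer ℂ (field '' (L : Set K)) := by
    ext A
    exact star_mem_iff (s := StarSubalgebra.centralizer ℂ (field '' (L : Set K)))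
  rw [h2, StarSubalgebra.coe_centralizer, h3, Set.union_self, h1]

/-- On the exterior algebra, `⊕ₙ X^{⊗n}` has as its graph the span of the pairs
`(ξ₁ ∧ ⋯ ∧ ξₙ, X ξ₁ ∧ ⋯ ∧ X ξₙ)`, `ξᵢ ∈ dom X`, `n ≥ 0`. -/
def secondQuantizationGraph (X : K →ₗ.[ℂ] K) : Submodule ℂ (Fock K × Fock K) :=
  LinearMap.range
    ((toFock.toLinearMap ∘ₗ (ExteriorAlgebra.map X.domain.subtype).toLinearMap).prod
      (toFock.toLinearMap ∘ₗ (ExteriorAlgebra.map X.toFun).toLinearMap))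

/-- The second quantization `⊕ₙ X^{⊗n}` on the antisymmetric Fock space, as a closed operator. -/
def secondQuantization (X : K →ₗ.[ℂ] K) : Fock K →ₗ.[ℂ] Fock K :=
  (secondQuantizationGraph X).topologicalClosure.toLinearPMap

/-- `X` is densely defined and `⟪ψ, X ψ⟫ > 0` for all nonzero `ψ ∈ dom X`; in particular `X` is
symmetric and injective. -/
def IsStrictlyPositiveOp (X : K →ₗ.[ℂ] K) : Prop :=
  Dense (X.domain : Set K) ∧ ∀ ψ : X.domain, ψ ≠ 0 → 0 < ⟪(ψ : K), X ψ⟫_ℂ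

/-- `Γ` is an antilinear involution with `Γ = Γ* = Γ⁻¹`, where the adjoint of an antilinear map is
given by `⟪Γ ψ, χ⟫ = conj ⟪ψ, Γ* χ⟫`. -/
def IsAntilinearInvolution (Γ : K →ₗ⋆[ℂ] K) : Prop :=
  (∀ ψ, Γ (Γ ψ) = ψ) ∧ ∀ ψ χ, ⟪Γ ψ, χ⟫_ℂ = conj ⟪ψ, Γ χ⟫_ℂ

/-- `X` commutes with `Γ`: `Γ` preserves `dom X` and `X Γ ψ = Γ X ψ` there. -/
def CommutesWith (X : K →ₗ.[ℂ] K) (Γ : K →ₗ⋆[ℂ] K) : Prop :=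
  ∀ ψ : X.domain, ∃ h : Γ ψ ∈ X.domain, X ⟨Γ ψ, h⟩ = Γ (X ψ)

/-- The real linear subspace `(1 + Γ) Lφ + (1 - Γ) Lπ`. -/
def realSubspace (Γ : K →ₗ⋆[ℂ] K) (Lφ Lπ : Submodule ℂ K) : Submodule ℝ K where
  carrier := {ψ | ∃ f ∈ Lφ, ∃ g ∈ Lπ, ψ = (f + Γ f) + (g - Γ g)}
  zero_mem' := ⟨0, Lφ.zero_mem, 0, Lπ.zero_mem, by simp⟩
  add_mem' := by
    rintro _ _ ⟨f, hf, g, hg, rfl⟩ ⟨f', hf', g', hg', rfl⟩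
    refine ⟨f + f', Lφ.add_mem hf hf', g + g', Lπ.add_mem hg hg', ?_⟩
    simp only [map_add]
    abel
  smul_mem' := by
    rintro c _ ⟨f, hf, g, hg, rfl⟩
    refine ⟨(c : ℂ) • f, Lφ.smul_mem _ hf, (c : ℂ) • g, Lπ.smul_mem _ hg, ?_⟩
    rw [LinearMap.map_smulₛₗ, LinearMap.map_smulₛₗ]
    simp only [Complex.conj_ofReal, Complex.coe_smul, smul_add, smul_sub]

/-- The map `Ξ(A) = X A Ω` on the von Neumann algebra generated by the fields over `L`, where `X`
stands for its second quantization. -/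
def nuclearityMap (X : K →ₗ.[ℂ] K) (L : Submodule ℝ K)
    (h : ∀ A ∈ fieldAlgebra L, A (vacuum K) ∈ (secondQuantization X).domain) :
    (fieldAlgebra L).toStarSubalgebra →ₗ[ℂ] Fock K where
  toFun A := secondQuantization X ⟨(A : Fock K →L[ℂ] Fock K) (vacuum K), h A A.2⟩
  map_add' A B := by
    rw [← LinearPMap.map_add]
    rfl
  map_smul' c A := by
    rw [RingHom.id_apply, ← LinearPMap.map_smul]
    rfl

end Fock

section WellDefined

variable {K : Type u} [NormedAddCommGroup K] [InnerProductSpace ℂ K]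

theorem IsStrictlyPositiveOp.symm {X : K →ₗ.[ℂ] K} (hX : IsStrictlyPositiveOp X)
    (ψ χ : X.domain) : ⟪X ψ, (χ : K)⟫_ℂ = ⟪(ψ : K), X χ⟫_ℂ := by
  have hr : ∀ ψ : X.domain, ⟪X ψ, (ψ : K)⟫_ℂ = ⟪(ψ : K), X ψ⟫_ℂ := by
    intro ψ
    by_cases h : ψ = 0
    · simp [h]
    · have h1 := (Complex.lt_def.1 (hX.2 ψ h)).2
      rw [← inner_conj_symm, Complex.conj_eq_iff_im]
      exact h1.symm
  have h1 := hr (ψ + χ)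
  have h2 := hr (ψ + Complex.I • χ)
  simp only [LinearPMap.map_add, LinearPMap.map_smul, Submodule.coe_add, Submodule.coe_smul,
    inner_add_left, inner_add_right, inner_smul_left, inner_smul_right, hr, Complex.conj_I] at h1 h2
  linear_combination (1 / 2 : ℂ) * h1 + (-Complex.I / 2) * h2
    + (1 / 2 : ℂ) * (⟪X ψ, (χ : K)⟫_ℂ - ⟪X χ, (ψ : K)⟫_ℂ - ⟪(ψ : K), X χ⟫_ℂ + ⟪(χ : K), X ψ⟫_ℂ)
      * Complex.I_sq

theorem contract_map {V : Submodule ℂ K} (f : V →ₗ[ℂ] K) (g : V →ₗ[ℂ] K) (v w : K)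
    (hvw : ∀ x, ⟪v, f x⟫_ℂ = ⟪w, g x⟫_ℂ) (z : ExteriorAlgebra ℂ V) :
    ∃ z', annihAlg v (ExteriorAlgebra.map f z) = ExteriorAlgebra.map f z' ∧
      annihAlg w (ExteriorAlgebra.map g z) = ExteriorAlgebra.map g z' := by
  induction z using CliffordAlgebra.left_induction with
  | algebraMap c =>
    refine ⟨0, ?_, ?_⟩
    · change annihAlg v (ExteriorAlgebra.map f (algebraMap ℂ (ExteriorAlgebra ℂ V) c)) = _
      rw [AlgHom.commutes, annihAlg_algebraMap, map_zero]
    · change annihAlg w (ExteriorAlgebra.map g (algebraMap ℂ (ExteriorAlgebra ℂ V) c)) = _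
      rw [AlgHom.commutes, annihAlg_algebraMap, map_zero]
  | add x y hx hy =>
    obtain ⟨a, ha, ha'⟩ := hx
    obtain ⟨b, hb, hb'⟩ := hy
    exact ⟨a + b, by rw [map_add, map_add, ha, hb, map_add],
      by rw [map_add, map_add, ha', hb', map_add]⟩
  | ι_mul x u hx =>
    obtain ⟨a, ha, ha'⟩ := hx
    refine ⟨⟪v, f u⟫_ℂ • x - ExteriorAlgebra.ι ℂ u * a, ?_, ?_⟩
    · change annihAlg v (ExteriorAlgebra.map f (ExteriorAlgebra.ι ℂ u * x)) = _
      rw [map_mul, ExteriorAlgebra.map_apply_ι, annihAlg_ι_mul, ha, map_sub, map_smul, map_mul,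
        ExteriorAlgebra.map_apply_ι]
    · change annihAlg w (ExteriorAlgebra.map g (ExteriorAlgebra.ι ℂ u * x)) = _
      rw [map_mul, ExteriorAlgebra.map_apply_ι, annihAlg_ι_mul, ha', map_sub, map_smul, map_mul,
        ExteriorAlgebra.map_apply_ι, hvw]

theorem inner_map_symm {X : K →ₗ.[ℂ] K} (hX : IsStrictlyPositiveOp X)
    (z : ExteriorAlgebra ℂ X.domain) : ∀ w : ExteriorAlgebra ℂ X.domain,
    ⟪ExteriorAlgebra.map X.toFun z, ExteriorAlgebra.map X.domain.subtype w⟫_ℂ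
      = ⟪ExteriorAlgebra.map X.domain.subtype z, ExteriorAlgebra.map X.toFun w⟫_ℂ := by
  induction z using CliffordAlgebra.left_induction with
  | algebraMap c =>
    intro w
    change ⟪ExteriorAlgebra.map X.toFun (algebraMap ℂ (ExteriorAlgebra ℂ X.domain) c), _⟫_ℂ
      = ⟪ExteriorAlgebra.map X.domain.subtype (algebraMap ℂ (ExteriorAlgebra ℂ X.domain) c), _⟫_ℂ
    rw [AlgHom.commutes, AlgHom.commutes, ← inner_conj_symm, ← inner_conj_symm _
      (ExteriorAlgebra.map X.toFun w)]
    congr 1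
    change gramForm _ _ = gramForm _ _
    rw [gramForm_algebraMap, gramForm_algebraMap]
    have h : ∀ f : X.domain →ₗ[ℂ] K,
        ExteriorAlgebra.algebraMapInv.comp (ExteriorAlgebra.map f)
          = ExteriorAlgebra.algebraMapInv := by
      intro f
      ext x
      simp [ExteriorAlgebra.algebraMapInv]
    rw [← AlgHom.comp_apply, ← AlgHom.comp_apply, h, h]
  | add x y hx hy =>
    intro w
    rw [map_add, map_add, inner_add_left, inner_add_left, hx, hy]
  | ι_mul x u hx =>
    intro w
    change ⟪ExteriorAlgebra.map X.toFun (ExteriorAlgebra.ι ℂ u * x), _⟫_ℂ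
      = ⟪ExteriorAlgebra.map X.domain.subtype (ExteriorAlgebra.ι ℂ u * x), _⟫_ℂ
    rw [map_mul, map_mul, ExteriorAlgebra.map_apply_ι, ExteriorAlgebra.map_apply_ι,
      inner_ι_mul_left, inner_ι_mul_left]
    obtain ⟨w', h1, h2⟩ := contract_map X.domain.subtype X.toFun (X.toFun u) (X.domain.subtype u)
      (fun x => hX.symm u x) w
    rw [h1, h2, hx]

theorem dense_map_domain {V : Submodule ℂ K} (hV : Dense (V : Set K)) (x : ExteriorAlgebra ℂ K) :
    x ∈ (LinearMap.range (ExteriorAlgebra.map V.subtype).toLinearMap).topologicalClosure := by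
  set R := LinearMap.range (ExteriorAlgebra.map V.subtype).toLinearMap with hR
  induction x using CliffordAlgebra.left_induction with
  | algebraMap c =>
    exact R.le_topologicalClosure ⟨algebraMap ℂ _ c, AlgHom.commutes _ c⟩
  | add x y hx hy => exact add_mem hx hy
  | ι_mul x u hx =>
    have h1 : ∀ v ∈ V, ∀ y ∈ R.topologicalClosure,
        ExteriorAlgebra.ι ℂ v * y ∈ R.topologicalClosure := by
      intro v hv y hy
      have hc := ((createAlg v).mkContinuous ‖v‖ (norm_createAlg_le v)).continuous
      have hm : Set.MapsTo ((createAlg v).mkContinuous ‖v‖ (norm_createAlg_le v))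
          (R : Set (ExteriorAlgebra ℂ K)) R := by
        rintro _ ⟨z, rfl⟩
        exact ⟨ExteriorAlgebra.ι ℂ ⟨v, hv⟩ * z, by
          simp [createAlg]⟩
      exact hm.closure hc hy
    have hlin : Continuous fun v : K => ExteriorAlgebra.ι ℂ v * x :=
      (LinearMap.mkContinuous ((LinearMap.mulRight ℂ x).comp (ExteriorAlgebra.ι ℂ)) ‖x‖
        (fun v => by rw [mul_comm]; exact norm_createAlg_le v x)).continuous
    have hm : Set.MapsTo (fun v : K => ExteriorAlgebra.ι ℂ v * x) (V : Set K)
        (R.topologicalClosure : Set (ExteriorAlgebra ℂ K)) := fun v hv => h1 v hv x hx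
    have := hm.closure hlin (hV u)
    rwa [R.isClosed_topologicalClosure.closure_eq] at this

/-- For a strictly positive `X`, the closure that defines the second quantization is the graph of an
operator. -/
theorem graph_secondQuantization {X : K →ₗ.[ℂ] K} (hX : IsStrictlyPositiveOp X) :
    (secondQuantization X).graph = (secondQuantizationGraph X).topologicalClosure := by
  refine Submodule.toLinearPMap_graph_eq _ ?_
  rintro ⟨x, y⟩ hxy hx
  change x = 0 at hx
  subst hx
  change y = 0
  have horth : ∀ w : ExteriorAlgebra ℂ X.domain,
      ⟪toFock (ExteriorAlgebra.map X.domain.subtype w), y⟫_ℂ = 0 := by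
    intro w
    let S : Set (Fock K × Fock K) := {p |
      ⟪toFock (ExteriorAlgebra.map X.domain.subtype w), p.2⟫_ℂ
        = ⟪toFock (ExteriorAlgebra.map X.toFun w), p.1⟫_ℂ}
    have hS : IsClosed S := isClosed_eq (by fun_prop) (by fun_prop)
    have hsub : (secondQuantizationGraph X : Set (Fock K × Fock K)) ⊆ S := by
      rintro _ ⟨z, rfl⟩
      change ⟪toFock _, toFock (ExteriorAlgebra.map X.toFun z)⟫_ℂ
        = ⟪toFock _, toFock (ExteriorAlgebra.map X.domain.subtype z)⟫_ℂ
      rw [LinearIsometry.inner_map_map, LinearIsometry.inner_map_map, inner_map_symm hX]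
    have := closure_minimal hsub hS hxy
    simpa [S] using this
  have hall : ∀ x : ExteriorAlgebra ℂ K, ⟪toFock x, y⟫_ℂ = 0 := by
    intro x
    have hc : IsClosed {x : ExteriorAlgebra ℂ K | ⟪toFock x, y⟫_ℂ = 0} :=
      isClosed_eq (toFock.continuous.inner continuous_const) continuous_const
    refine closure_minimal ?_ hc (dense_map_domain hX.1 x)
    rintro _ ⟨w, rfl⟩
    exact horth w
  have hy : ∀ z : Fock K, ⟪z, y⟫_ℂ = 0 := fun z =>
    denseRange_toFock.induction_on (p := fun z => ⟪z, y⟫_ℂ = 0) z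
      (isClosed_eq (by fun_prop) continuous_const) hall
  exact inner_self_eq_zero.1 (hy y)

end WellDefined

section Operators

variable {K : Type u} [NormedAddCommGroup K] [InnerProductSpace ℂ K] [CompleteSpace K]

variable (K) in
/-- Some orthonormal basis of the Hilbert space `K`. -/
def onBasis : HilbertBasis (exists_hilbertBasis ℂ K).choose ℂ K :=
  (exists_hilbertBasis ℂ K).choose_spec.choose

/-- `T` is trace class: `|T| = (T* T)^{1/2}` has finite trace. (The summability and the value of the
trace of a positive operator do not depend on the orthonormal basis.) -/
def IsTraceClass (T : K →L[ℂ] K) : Prop :=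
  Summable fun i => (⟪onBasis K i, CFC.abs T (onBasis K i)⟫_ℂ).re

/-- The trace norm `‖T‖₁ = Tr |T|` of a trace class operator. -/
def traceNorm (T : K →L[ℂ] K) : ℝ :=
  ∑' i, (⟪onBasis K i, CFC.abs T (onBasis K i)⟫_ℂ).re

/-- The determinant `det (1 + S) = ∏ⱼ (1 + sⱼ)` for a positive trace class operator `S` with
eigenvalues `sⱼ`, repeated according to multiplicity. (Eigenspaces to nonzero eigenvalues are finite
dimensional, and the factor of the eigenvalue zero is one.) -/
def detOneAdd (S : K →L[ℂ] K) : ℝ :=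
  ∏' s : ℝ, (1 + s) ^ Module.finrank ℂ (Module.End.eigenspace (S : K →ₗ[ℂ] K) (s : ℂ))

/-- The positive operator `(|T₁|² + |T₂|²)^{1/2}`. -/
def sqrtSumSq (T₁ T₂ : K →L[ℂ] K) : K →L[ℂ] K :=
  CFC.sqrt (CFC.abs T₁ ^ 2 + CFC.abs T₂ ^ 2)

end Operators

section Nuclear

variable {E F : Type*} [NormedAddCommGroup E] [NormedSpace ℂ E] [NormedAddCommGroup F]
  [NormedSpace ℂ F]

/-- `Ξ = ∑ₖ ρₖ(·) Ψₖ` with `∑ₖ ‖ρₖ‖ ‖Ψₖ‖ < ∞`. -/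
def IsNuclearRep (Ξ : E →ₗ[ℂ] F) (ρ : ℕ → StrongDual ℂ E) (Ψ : ℕ → F) : Prop :=
  (∀ A, HasSum (fun k => ρ k A • Ψ k) (Ξ A)) ∧ Summable fun k => ‖ρ k‖ * ‖Ψ k‖

/-- A linear map between Banach spaces is nuclear if it has a nuclear representation. -/
def IsNuclear (Ξ : E →ₗ[ℂ] F) : Prop := ∃ ρ Ψ, IsNuclearRep Ξ ρ Ψ

/-- The nuclear norm: the infimum of `∑ₖ ‖ρₖ‖ ‖Ψₖ‖` over all nuclear representations. -/
def nuclearNorm (Ξ : E →ₗ[ℂ] F) : ℝ :=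
  sInf {r | ∃ ρ Ψ, IsNuclearRep Ξ ρ Ψ ∧ r = ∑' k, ‖ρ k‖ * ‖Ψ k‖}

end Nuclear

end FermiFock

end

/-! The vector `XAΩ` is expanded in the orthonormal basis of Fock space formed by the wedge products
of eigenvectors `b j` of `2T`, with eigenvalues `σ j`. If each coefficient is a functional of norm
at most `∏ j ∈ s, σ j`, then the nuclear norm is at most `∑ s, ∏ j ∈ s, σ j = ∏ j, (1 + σ j) = det(1
+ 2T)`.

The coefficients are controlled by an algebraic trick (`exists_annihilation_eq`). Put `u = Eφ ψ`, `v
= Eπ ψ`. The operator `b = a*(Γ(u - v)) + a(u + v)` belongs to the field algebra, and for `χ ∈ L`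
its anticommutator with `φ(χ)` is `2⟪ψ, χ⟫`, twice that of `a(ψ)`. So the odd operator `a(ψ) - b/2`
anticommutes with all generating fields and has vanishing graded commutator with the algebra. Since
`a(ψ)Ω = 0`, this gives `a(ψ)AΩ = ½(bA - A'b)Ω`, where `A'` is the parity conjugate of `A`. The
right side is again an algebra element applied to `Ω`, and its norm costs only a factor `‖u - v‖ +
‖u + v‖`. Iteration handles wedge products, and symmetry of `X` puts `X` on the wedge factors, which
turns `Eφ ψ`, `Eπ ψ` into `Tφ ξ`, `Tπ ξ` (`norm_inner_wedge_nuclearityMap_le`). The parallelogram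
law bounds each factor by `2‖T ξ‖`, which is `σ j` at `ξ = b j`.

The exponential bound follows from `1 + s ≤ exp s` and `Tr T ≤ Tr |Tφ| + Tr |Tπ|`. For the latter,
`T² = |Tφ|² + |Tπ|²` yields contractions with `|Tφ| = CT`, `|Tπ| = DT` and hence `T = C*|Tφ| +
D*|Tπ|` (`summable_trace_and_tsum_le`). -/

noncomputable section

namespace FermiFock

universe u

/-! ### Canonical anticommutation relations on Fock space -/

section CAR

variable {K : Type u} [NormedAddCommGroup K] [InnerProductSpace ℂ K]

theorem fock_ext {A B : Fock K →L[ℂ] Fock K} (h : ∀ x, A (toFock x) = B (toFock x)) : A = B :=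
  ContinuousLinearMap.ext fun z => denseRange_toFock.induction_on
    (p := fun z => A z = B z) z (isClosed_eq A.continuous B.continuous) h

theorem fock_inner_ext {y z : Fock K} (h : ∀ x, ⟪toFock x, y⟫_ℂ = ⟪toFock x, z⟫_ℂ) : y = z :=
  ext_inner_left ℂ fun w => denseRange_toFock.induction_on
    (p := fun w => ⟪w, y⟫_ℂ = ⟪w, z⟫_ℂ) w (isClosed_eq (by fun_prop) (by fun_prop)) h

/-- Identifies the adjoint that defines `annihilation` with contraction on a dense subspace, so that
relations between operators can be checked in the exterior algebra. -/
theorem annihilation_toFock (ψ : K) (x : ExteriorAlgebra ℂ K) :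
    annihilation ψ (toFock x) = toFock (annihAlg ψ x) := by
  refine fock_inner_ext fun y => ?_
  rw [annihilation, ContinuousLinearMap.adjoint_inner_right, creation_toFock,
    LinearIsometry.inner_map_map, LinearIsometry.inner_map_map, inner_ι_mul_left]

theorem annihilation_vacuum (ψ : K) : annihilation ψ (vacuum K) = 0 := by
  rw [vacuum, annihilation_toFock, ← map_one (algebraMap ℂ (ExteriorAlgebra ℂ K)),
    annihAlg_algebraMap, map_zero]

theorem creation_add (ψ χ : K) : creation (ψ + χ) = creation ψ + creation χ :=
  fock_ext fun x => by simp [creation_toFock, add_mul]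

theorem creation_smul (c : ℂ) (ψ : K) : creation (c • ψ) = c • creation ψ :=
  fock_ext fun x => by simp [creation_toFock]

theorem norm_creation_le (ψ : K) : ‖creation ψ‖ ≤ ‖ψ‖ :=
  ContinuousLinearMap.opNorm_le_bound _ (norm_nonneg _) fun z => denseRange_toFock.induction_on
    (p := fun z => ‖creation ψ z‖ ≤ ‖ψ‖ * ‖z‖) z (isClosed_le (by fun_prop) (by fun_prop))
    fun x => by
      rw [creation_toFock, LinearIsometry.norm_map, LinearIsometry.norm_map]
      exact norm_createAlg_le ψ x

/-- The creation operator as a continuous linear function of its argument. -/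
def creationCLM : K →L[ℂ] Fock K →L[ℂ] Fock K :=
  LinearMap.mkContinuous ⟨⟨creation, creation_add⟩, creation_smul⟩ 1 fun ψ => by
    simpa using norm_creation_le ψ

theorem continuous_creation : Continuous (creation : K → Fock K →L[ℂ] Fock K) :=
  creationCLM.continuous

theorem annihilation_add (ψ χ : K) : annihilation (ψ + χ) = annihilation ψ + annihilation χ := by
  simp [annihilation, creation_add]

theorem annihilation_smul (c : ℂ) (ψ : K) : annihilation (c • ψ) = conj c • annihilation ψ := by
  rw [annihilation, creation_smul, map_smulₛₗ]
  rfl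

theorem norm_annihilation_le (ψ : K) : ‖annihilation ψ‖ ≤ ‖ψ‖ := by
  rw [annihilation, LinearIsometryEquiv.norm_map]
  exact norm_creation_le ψ

theorem annihilation_mul_creation (ψ χ : K) :
    annihilation ψ * creation χ + creation χ * annihilation ψ = ⟪ψ, χ⟫_ℂ • 1 :=
  fock_ext fun x => by
    simp [creation_toFock, annihilation_toFock, annihAlg_ι_mul]

theorem creation_mul_creation (ψ χ : K) :
    creation ψ * creation χ + creation χ * creation ψ = 0 :=
  fock_ext fun x => by
    have h := ExteriorAlgebra.ι_add_mul_swap (R := ℂ) ψ χ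
    simp [creation_toFock, ← map_add, ← mul_assoc, ← add_mul, h]

theorem annihilation_mul_annihilation (ψ χ : K) :
    annihilation ψ * annihilation χ + annihilation χ * annihilation ψ = 0 := by
  have h := congrArg star (creation_mul_creation ψ χ)
  simpa [annihilation, star_add, star_mul, ContinuousLinearMap.star_eq_adjoint, add_comm] using h

/-- Anticommutator of `a*(η) + a(θ)` with a field operator. -/
theorem anticommutator_field (η θ χ : K) :
    (creation η + annihilation θ) * field χ + field χ * (creation η + annihilation θ)
      = (⟪χ, η⟫_ℂ + ⟪θ, χ⟫_ℂ) • 1 := by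
  have h1 := annihilation_mul_creation χ η
  have h2 := annihilation_mul_creation θ χ
  have h3 := creation_mul_creation η χ
  have h4 := annihilation_mul_annihilation θ χ
  rw [add_smul, ← h1, ← h2, field]
  calc _ = (creation η * creation χ + creation χ * creation η)
      + (annihilation θ * annihilation χ + annihilation χ * annihilation θ)
      + (annihilation χ * creation η + creation η * annihilation χ)
      + (annihilation θ * creation χ + creation χ * annihilation θ) := by noncomm_ring
    _ = _ := by rw [h3, h4, zero_add, zero_add]

end CAR

/-! ### The parity operator -/

section Parity

variable {K : Type u} [NormedAddCommGroup K] [InnerProductSpace ℂ K]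

/-- The grading automorphism of the exterior algebra. -/
def parityAlg : ExteriorAlgebra ℂ K →ₐ[ℂ] ExteriorAlgebra ℂ K :=
  ExteriorAlgebra.map (-LinearMap.id)

theorem parityAlg_ι_mul (v : K) (x : ExteriorAlgebra ℂ K) :
    parityAlg (ExteriorAlgebra.ι ℂ v * x) = -(ExteriorAlgebra.ι ℂ v * parityAlg x) := by
  simp [parityAlg, ExteriorAlgebra.map_apply_ι]

theorem parityAlg_parityAlg (x : ExteriorAlgebra ℂ K) : parityAlg (parityAlg x) = x := by
  rw [parityAlg, ← AlgHom.comp_apply, ExteriorAlgebra.map_comp_map]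
  simp

theorem annihAlg_parityAlg (v : K) (x : ExteriorAlgebra ℂ K) :
    annihAlg v (parityAlg x) = -parityAlg (annihAlg v x) := by
  induction x using CliffordAlgebra.left_induction with
  | algebraMap c =>
    change annihAlg v (parityAlg (algebraMap ℂ (ExteriorAlgebra ℂ K) c))
      = -parityAlg (annihAlg v (algebraMap ℂ (ExteriorAlgebra ℂ K) c))
    rw [AlgHom.commutes, annihAlg_algebraMap, map_zero, neg_zero]
  | add x y hx hy => simp only [map_add, hx, hy, neg_add]
  | ι_mul x u hx =>
    change annihAlg v (parityAlg (ExteriorAlgebra.ι ℂ u * x))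
      = -parityAlg (annihAlg v (ExteriorAlgebra.ι ℂ u * x))
    rw [parityAlg_ι_mul, map_neg, annihAlg_ι_mul, annihAlg_ι_mul, map_sub, map_smul,
      parityAlg_ι_mul, hx]
    simp

theorem inner_parityAlg_left (x : ExteriorAlgebra ℂ K) :
    ∀ y, ⟪parityAlg x, y⟫_ℂ = ⟪x, parityAlg y⟫_ℂ := by
  induction x using CliffordAlgebra.left_induction with
  | algebraMap c =>
    intro y
    change ⟪parityAlg (algebraMap ℂ (ExteriorAlgebra ℂ K) c), y⟫_ℂ
      = ⟪algebraMap ℂ (ExteriorAlgebra ℂ K) c, parityAlg y⟫_ℂ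
    rw [AlgHom.commutes, ← inner_conj_symm, ← inner_conj_symm _ (parityAlg y)]
    congr 1
    change gramForm _ _ = gramForm _ _
    rw [gramForm_algebraMap, gramForm_algebraMap]
    have h : ExteriorAlgebra.algebraMapInv.comp (parityAlg (K := K))
        = ExteriorAlgebra.algebraMapInv := by
      ext x
      simp [ExteriorAlgebra.algebraMapInv, parityAlg]
    rw [← AlgHom.comp_apply, h]
  | add x x' hx hx' =>
    intro y
    rw [map_add, inner_add_left, inner_add_left, hx, hx']
  | ι_mul x u hx =>
    intro y
    change ⟪parityAlg (ExteriorAlgebra.ι ℂ u * x), y⟫_ℂ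
      = ⟪ExteriorAlgebra.ι ℂ u * x, parityAlg y⟫_ℂ
    rw [parityAlg_ι_mul, inner_neg_left, inner_ι_mul_left, inner_ι_mul_left, annihAlg_parityAlg,
      hx, inner_neg_right]

theorem norm_parityAlg (x : ExteriorAlgebra ℂ K) : ‖parityAlg x‖ = ‖x‖ := by
  rw [@norm_eq_sqrt_re_inner ℂ, @norm_eq_sqrt_re_inner ℂ _ _ _ _ x, inner_parityAlg_left,
    parityAlg_parityAlg]

/-- The parity operator `(-1)^N` on Fock space. -/
def parity : Fock K →L[ℂ] Fock K :=
  (toFock.toLinearMap ∘ₗ parityAlg.toLinearMap : ExteriorAlgebra ℂ K →ₗ[ℂ] Fock K).extendOfNorm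
    toFock.toLinearMap

theorem norm_toFock_parityAlg_le (x : ExteriorAlgebra ℂ K) :
    ‖(toFock.toLinearMap ∘ₗ parityAlg.toLinearMap : ExteriorAlgebra ℂ K →ₗ[ℂ] Fock K) x‖
      ≤ 1 * ‖toFock.toLinearMap x‖ := by
  simp [norm_parityAlg]

theorem parity_toFock (x : ExteriorAlgebra ℂ K) : parity (toFock x) = toFock (parityAlg x) :=
  LinearMap.extendOfNorm_eq (e := toFock.toLinearMap) denseRange_toFock
    ⟨1, norm_toFock_parityAlg_le⟩ x

theorem norm_parity_le : ‖(parity : Fock K →L[ℂ] Fock K)‖ ≤ 1 :=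
  LinearMap.opNorm_extendOfNorm_le denseRange_toFock zero_le_one norm_toFock_parityAlg_le

theorem parity_mul_parity : (parity : Fock K →L[ℂ] Fock K) * parity = 1 :=
  fock_ext fun x => by simp [parity_toFock, parityAlg_parityAlg]

theorem parity_mul_creation (ψ : K) : parity * creation ψ = -(creation ψ * parity) :=
  fock_ext fun x => by simp [parity_toFock, creation_toFock, parityAlg_ι_mul]

theorem parity_mul_annihilation (ψ : K) : parity * annihilation ψ = -(annihilation ψ * parity) :=
  fock_ext fun x => by simp [parity_toFock, annihilation_toFock, annihAlg_parityAlg]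

theorem parity_mul_field (ψ : K) : parity * field ψ = -(field ψ * parity) := by
  rw [field, mul_add, parity_mul_creation, parity_mul_annihilation, add_mul, neg_add]

end Parity

/-! ### Graded commutation with the field algebra -/

section FieldAlgebra

variable {K : Type u} [NormedAddCommGroup K] [InnerProductSpace ℂ K] {L : Submodule ℝ K}

/-- The bicommutant in testable form: facts about the whole von Neumann algebra reduce to exhibiting
operators that commute with the generating fields, without any topological closure. -/
theorem mem_fieldAlgebra_iff {A : Fock K →L[ℂ] Fock K} :
    A ∈ fieldAlgebra L ↔ ∀ B, (∀ ψ ∈ L, field ψ * B = B * field ψ) → B * A = A * B := by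
  rw [← SetLike.mem_coe, coe_fieldAlgebra]
  simp [Set.mem_centralizer_iff]

theorem field_mem_fieldAlgebra {ψ : K} (hψ : ψ ∈ L) : field ψ ∈ fieldAlgebra L :=
  mem_fieldAlgebra_iff.2 fun _ hB => (hB ψ hψ).symm

/-- Conjugation by `parity` changes the sign of every field, so it preserves the commutant of the
fields and therefore the bicommutant. -/
theorem parity_conj_mem_fieldAlgebra {A : Fock K →L[ℂ] Fock K} (hA : A ∈ fieldAlgebra L) :
    parity * A * parity ∈ fieldAlgebra L := by
  refine mem_fieldAlgebra_iff.2 fun B hB => ?_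
  have hP := parity_mul_parity (K := K)
  have h := mem_fieldAlgebra_iff.1 hA (parity * B * parity) fun ψ hψ => by
    have h1 := parity_mul_field ψ
    have h2 : field ψ * parity = -(parity * field ψ) := by rw [h1, neg_neg]
    calc field ψ * (parity * B * parity) = (field ψ * parity) * B * parity := by noncomm_ring
      _ = -(parity * (field ψ * B) * parity) := by rw [h2]; noncomm_ring
      _ = -(parity * B * (field ψ * parity)) := by rw [hB ψ hψ]; noncomm_ring
      _ = parity * B * parity * field ψ := by rw [h2]; noncomm_ring
  calc B * (parity * A * parity)
      = (parity * parity) * B * (parity * A * parity) := by rw [hP, one_mul]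
    _ = parity * (parity * B * parity * A) * parity := by noncomm_ring
    _ = (parity * A * parity) * B * (parity * parity) := by rw [h]; noncomm_ring
    _ = parity * A * parity * B := by rw [hP, mul_one]

/-- An odd operator that anticommutes with the generating fields has vanishing graded commutator
with the whole von Neumann algebra. -/
theorem mul_eq_parity_conj_mul {C A : Fock K →L[ℂ] Fock K} (hA : A ∈ fieldAlgebra L)
    (hC : ∀ ψ ∈ L, C * field ψ + field ψ * C = 0) (hodd : parity * C = -(C * parity)) :
    C * A = parity * A * parity * C := by
  have hP := parity_mul_parity (K := K)
  have hodd' : C * parity = -(parity * C) := by rw [hodd, neg_neg]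
  -- Klein trick: `C` and `parity` both anticommute with the generating fields, so their product
  -- commutes with them and hence with `A`.
  have h := mem_fieldAlgebra_iff.1 hA (C * parity) fun ψ hψ => by
    have h1 := eq_neg_of_add_eq_zero_right (hC ψ hψ)
    rw [← mul_assoc, h1, mul_assoc C parity, parity_mul_field]
    noncomm_ring
  calc C * A = -(parity * (C * parity * A)) := by
        rw [hodd']
        simp only [mul_assoc, neg_mul, mul_neg, neg_neg]
        rw [← mul_assoc parity parity, hP, one_mul]
    _ = parity * A * parity * C := by rw [h, hodd']; noncomm_ring

theorem norm_parity_conj_le (A : Fock K →L[ℂ] Fock K) : ‖parity * A * parity‖ ≤ ‖A‖ := by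
  have hP := norm_parity_le (K := K)
  calc ‖parity * A * parity‖ ≤ ‖parity‖ * ‖A‖ * ‖parity‖ :=
        (norm_mul_le _ _).trans (by gcongr; exact norm_mul_le _ _)
    _ ≤ 1 * ‖A‖ * 1 := by gcongr
    _ = ‖A‖ := by ring

end FieldAlgebra

/-! ### Annihilation operators as inner graded derivations -/

section LocalAnnihilation

variable {K : Type u} [NormedAddCommGroup K] [InnerProductSpace ℂ K]

theorem IsAntilinearInvolution.norm_map {Γ : K →ₗ⋆[ℂ] K} (hΓ : IsAntilinearInvolution Γ) (ψ : K) :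
    ‖Γ ψ‖ = ‖ψ‖ := by
  rw [@norm_eq_sqrt_re_inner ℂ, @norm_eq_sqrt_re_inner ℂ _ _ _ _ ψ, hΓ.2, hΓ.1]
  simp

/-- Fields are only real linear in their argument. Rotating `u` and `v` by a phase and combining two
fields with complex coefficients uses linearity of `a*` against antilinearity of `a`: only `Γ(u -
v)` survives in the creation part and only `u + v` in the annihilation part. -/
theorem creation_add_annihilation_mem (Γ : K →ₗ⋆[ℂ] K) {Lφ Lπ : Submodule ℂ K} {u v : K}
    (hu : u ∈ Lφ) (hv : v ∈ Lπ) :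
    creation (Γ (u - v)) + annihilation (u + v) ∈ fieldAlgebra (realSubspace Γ Lφ Lπ) := by
  have key : ∀ c : ℂ, ((c • u + Γ (c • u)) + (c • v - Γ (c • v))) ∈ realSubspace Γ Lφ Lπ :=
    fun c => ⟨c • u, Lφ.smul_mem c hu, c • v, Lπ.smul_mem c hv, rfl⟩
  have h : creation (Γ (u - v)) + annihilation (u + v)
      = field (((1 / 2 : ℂ) • u + Γ ((1 / 2 : ℂ) • u)) + ((1 / 2 : ℂ) • v - Γ ((1 / 2 : ℂ) • v)))
        + (-Complex.I) • field (((-Complex.I / 2 : ℂ) • u + Γ ((-Complex.I / 2 : ℂ) • u))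
          + ((-Complex.I / 2 : ℂ) • v - Γ ((-Complex.I / 2 : ℂ) • v))) := by
    have ha : ∀ w : K, (-Complex.I) • annihilation w = annihilation (Complex.I • w) := fun w => by
      rw [annihilation_smul, Complex.conj_I]
    rw [field, field, smul_add, ← creation_smul, ha, add_add_add_comm, ← creation_add,
      ← annihilation_add]
    have h2 : conj (2 : ℂ) = 2 := map_ofNat (starRingEnd ℂ) 2
    have hc : conj (1 / 2 : ℂ) = 1 / 2 := by simp [h2]
    have hc' : conj (-Complex.I / 2) = Complex.I / 2 := by simp [h2]
    simp only [map_sub, LinearMap.map_smulₛₗ, hc, hc', smul_add, smul_sub, smul_smul]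
    congr 2
    · match_scalars <;> ring_nf <;> simp <;> ring_nf
    · match_scalars <;> ring_nf <;> simp <;> ring_nf
  rw [h]
  exact add_mem (field_mem_fieldAlgebra (key _))
    ((fieldAlgebra _).toStarSubalgebra.smul_mem (field_mem_fieldAlgebra (key _)) _)

/-- Write `χ = F + G` with `F = f + Γ f ∈ Lφ` and `G = g - Γ g ∈ Lπ`; then `Γ χ = F - G`. With `u`,
`v` the two projections of `ψ`, the left side is `⟪u - v, F - G⟫ + ⟪u + v, F + G⟫`, where the cross
terms cancel and the projections can be dropped. -/
theorem inner_add_inner_realSubspace {Γ : K →ₗ⋆[ℂ] K} (hΓ : IsAntilinearInvolution Γ)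
    {Lφ Lπ : Submodule ℂ K} [Lφ.HasOrthogonalProjection] [Lπ.HasOrthogonalProjection]
    (hLφ : ∀ ψ ∈ Lφ, Γ ψ ∈ Lφ) (hLπ : ∀ ψ ∈ Lπ, Γ ψ ∈ Lπ)
    (ψ : K) {χ : K} (hχ : χ ∈ realSubspace Γ Lφ Lπ) :
    ⟪χ, Γ (Lφ.starProjection ψ - Lπ.starProjection ψ)⟫_ℂ
      + ⟪Lφ.starProjection ψ + Lπ.starProjection ψ, χ⟫_ℂ = 2 * ⟪ψ, χ⟫_ℂ := by
  obtain ⟨f, hf, g, hg, rfl⟩ := hχ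
  rw [← inner_conj_symm, hΓ.2, Complex.conj_conj]
  have h1 : ⟪Lφ.starProjection ψ, f + Γ f⟫_ℂ = ⟪ψ, f + Γ f⟫_ℂ := by
    rw [Submodule.inner_starProjection_left_eq_right,
      Submodule.starProjection_eq_self_iff.2 (Lφ.add_mem hf (hLφ f hf))]
  have h2 : ⟪Lπ.starProjection ψ, g - Γ g⟫_ℂ = ⟪ψ, g - Γ g⟫_ℂ := by
    rw [Submodule.inner_starProjection_left_eq_right,
      Submodule.starProjection_eq_self_iff.2 (Lπ.sub_mem hg (hLπ g hg))]
  have h3 : Γ (f + Γ f + (g - Γ g)) = f + Γ f - (g - Γ g) := by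
    simp only [map_add, map_sub, hΓ.1]
    abel
  rw [h3]
  simp only [inner_add_left, inner_sub_left, inner_add_right _ (f + Γ f),
    inner_sub_right _ (f + Γ f)]
  rw [h1, h2]
  ring

/-- On `A Ω`, with `A` in the field algebra, annihilation operators act as an inner graded
derivation of the field algebra. -/
theorem exists_annihilation_eq {Γ : K →ₗ⋆[ℂ] K} (hΓ : IsAntilinearInvolution Γ)
    {Lφ Lπ : Submodule ℂ K} [Lφ.HasOrthogonalProjection] [Lπ.HasOrthogonalProjection]
    (hLφ : ∀ ψ ∈ Lφ, Γ ψ ∈ Lφ) (hLπ : ∀ ψ ∈ Lπ, Γ ψ ∈ Lπ) (ψ : K) {A : Fock K →L[ℂ] Fock K}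
    (hA : A ∈ fieldAlgebra (realSubspace Γ Lφ Lπ)) :
    ∃ B ∈ fieldAlgebra (realSubspace Γ Lφ Lπ),
      annihilation ψ (A (vacuum K)) = B (vacuum K) ∧
      ‖B‖ ≤ (‖Lφ.starProjection ψ - Lπ.starProjection ψ‖
        + ‖Lφ.starProjection ψ + Lπ.starProjection ψ‖) * ‖A‖ := by
  set u := Lφ.starProjection ψ with hu
  set v := Lπ.starProjection ψ with hv
  set b := creation (Γ (u - v)) + annihilation (u + v) with hb
  have hbmem : b ∈ fieldAlgebra (realSubspace Γ Lφ Lπ) :=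
    creation_add_annihilation_mem Γ (Lφ.starProjection_apply_mem ψ) (Lπ.starProjection_apply_mem ψ)
  have hbnorm : ‖b‖ ≤ ‖u - v‖ + ‖u + v‖ := by
    refine (norm_add_le _ _).trans (add_le_add ?_ (norm_annihilation_le _))
    exact (norm_creation_le _).trans (hΓ.norm_map _).le
  -- Both `a(ψ)` and `b/2` have anticommutator `⟪ψ, χ⟫` with `φ(χ)`, so their difference
  -- anticommutes with the generating fields.
  have hgc : (annihilation ψ - (1 / 2 : ℂ) • b) * A
      = parity * A * parity * (annihilation ψ - (1 / 2 : ℂ) • b) := by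
    refine mul_eq_parity_conj_mul hA (fun χ hχ => ?_) ?_
    · have h1 := anticommutator_field (Γ (u - v)) (u + v) χ
      have h2 := anticommutator_field 0 ψ χ
      have h0 : creation (0 : K) = 0 := by simpa using creation_smul 0 (0 : K)
      rw [h0, zero_add, inner_zero_right, zero_add] at h2
      rw [inner_add_inner_realSubspace hΓ hLφ hLπ ψ hχ, ← hb] at h1
      calc _ = (annihilation ψ * field χ + field χ * annihilation ψ)
            - (1 / 2 : ℂ) • (b * field χ + field χ * b) := by
            rw [sub_mul, mul_sub, smul_mul_assoc, mul_smul_comm, smul_add]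
            abel
        _ = 0 := by
            rw [h1, h2, smul_smul]
            simp
    · rw [mul_sub, sub_mul, mul_smul_comm, smul_mul_assoc, hb, mul_add, add_mul,
        parity_mul_annihilation, parity_mul_annihilation, parity_mul_creation]
      simp only [smul_add, smul_neg]
      abel
  -- The witness comes from applying `hgc` to the vacuum, where `a(ψ)` drops out on the right. The
  -- factor `1/2` compensates for the two terms in the norm estimate.
  refine ⟨(1 / 2 : ℂ) • (b * A - parity * A * parity * b), ?_, ?_, ?_⟩
  · exact (fieldAlgebra _).toStarSubalgebra.smul_mem
      (sub_mem (mul_mem hbmem hA) (mul_mem (parity_conj_mem_fieldAlgebra hA) hbmem)) _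
  · have h := congrArg (fun T : Fock K →L[ℂ] Fock K => T (vacuum K)) hgc
    simp only [ContinuousLinearMap.mul_def, ContinuousLinearMap.comp_apply, sub_apply, smul_apply,
      annihilation_vacuum, zero_sub, map_neg, map_smul] at h
    simp only [ContinuousLinearMap.mul_def, ContinuousLinearMap.comp_apply, sub_apply, smul_apply,
      smul_sub]
    rw [sub_eq_iff_eq_add] at h
    rw [h]
    abel
  · have h1 : ‖b * A‖ ≤ ‖b‖ * ‖A‖ := norm_mul_le _ _
    have h2 : ‖parity * A * parity * b‖ ≤ ‖A‖ * ‖b‖ :=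
      (norm_mul_le _ _).trans (by gcongr; exact norm_parity_conj_le A)
    have h3 := norm_sub_le (b * A) (parity * A * parity * b)
    have h4 : ‖b‖ * ‖A‖ ≤ (‖u - v‖ + ‖u + v‖) * ‖A‖ := by gcongr
    rw [norm_smul]
    norm_num
    linarith

end LocalAnnihilation

/-! ### Wedge vectors and symmetry of the second quantization -/

section Wedge

variable {K : Type u} [NormedAddCommGroup K] [InnerProductSpace ℂ K]

/-- The vector `ψ₁ ∧ ⋯ ∧ ψₙ` of Fock space. -/
def wedge (l : List K) : Fock K := toFock (l.map (ExteriorAlgebra.ι ℂ)).prod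

theorem wedge_nil : wedge ([] : List K) = vacuum K := rfl

theorem wedge_cons (ψ : K) (l : List K) : wedge (ψ :: l) = creation ψ (wedge l) := by
  simp [wedge, creation_toFock]

theorem norm_vacuum : ‖vacuum K‖ = 1 := by
  have h : ⟪vacuum K, vacuum K⟫_ℂ = 1 := by
    rw [vacuum, LinearIsometry.inner_map_map]
    change gramForm 1 1 = 1
    have := gramForm_algebraMap (K := K) 1 1
    simpa using this
  rw [@norm_eq_sqrt_re_inner ℂ, h]
  simp

/-- Serves to pass from wedge factors in `dom X` to arbitrary ones, since eigenvectors of `T` need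
not lie in `dom X`. -/
theorem continuous_wedge_ofFn (n : ℕ) :
    Continuous fun ξ : Fin n → K => wedge (List.ofFn ξ) := by
  induction n with
  | zero => simpa using continuous_const
  | succ n ih =>
    simp only [List.ofFn_succ, wedge_cons]
    exact (continuous_creation.comp (continuous_apply 0)).clm_apply
      (ih.comp (continuous_pi fun i => continuous_apply i.succ))

/-- Symmetry holds between vectors of the algebraic core; for fixed `w` it is a closed condition on
the graph, so it survives the closure. -/
theorem inner_secondQuantization {X : K →ₗ.[ℂ] K} (hX : IsStrictlyPositiveOp X)
    (w : ExteriorAlgebra ℂ X.domain) (y : (secondQuantization X).domain) :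
    ⟪toFock (ExteriorAlgebra.map X.domain.subtype w), secondQuantization X y⟫_ℂ
      = ⟪toFock (ExteriorAlgebra.map X.toFun w), (y : Fock K)⟫_ℂ := by
  let S : Set (Fock K × Fock K) := {p |
    ⟪toFock (ExteriorAlgebra.map X.domain.subtype w), p.2⟫_ℂ
      = ⟪toFock (ExteriorAlgebra.map X.toFun w), p.1⟫_ℂ}
  have hS : IsClosed S := isClosed_eq (by fun_prop) (by fun_prop)
  have hsub : (secondQuantizationGraph X : Set (Fock K × Fock K)) ⊆ S := by
    rintro _ ⟨z, rfl⟩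
    change ⟪toFock _, toFock (ExteriorAlgebra.map X.toFun z)⟫_ℂ
      = ⟪toFock _, toFock (ExteriorAlgebra.map X.domain.subtype z)⟫_ℂ
    rw [LinearIsometry.inner_map_map, LinearIsometry.inner_map_map, inner_map_symm hX]
  have hmem : ((y : Fock K), secondQuantization X y) ∈ (secondQuantization X).graph :=
    (secondQuantization X).mem_graph y
  rw [graph_secondQuantization hX] at hmem
  exact closure_minimal hsub hS hmem

theorem inner_wedge_secondQuantization {X : K →ₗ.[ℂ] K} (hX : IsStrictlyPositiveOp X)
    (l : List X.domain) (y : (secondQuantization X).domain) :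
    ⟪wedge (l.map X.domain.subtype), secondQuantization X y⟫_ℂ
      = ⟪wedge (l.map X), (y : Fock K)⟫_ℂ := by
  have h := inner_secondQuantization hX (l.map (ExteriorAlgebra.ι ℂ)).prod y
  have h1 : ∀ f : X.domain →ₗ[ℂ] K, ExteriorAlgebra.map f (l.map (ExteriorAlgebra.ι ℂ)).prod
      = ((l.map f).map (ExteriorAlgebra.ι ℂ)).prod := fun f => by
    rw [map_list_prod, List.map_map, List.map_map]
    congr 2
    ext x
    simp
  rw [h1, h1] at h
  exact h

end Wedge

/-! ### Bounds on the coefficients against wedge vectors -/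

section CoefficientBound

variable {K : Type u} [NormedAddCommGroup K] [InnerProductSpace ℂ K]

/-- Each wedge factor moves to the right side as an annihilation operator and is absorbed into a new
algebra element; hence the induction must be uniform in `A`. -/
theorem norm_inner_wedge_le {Γ : K →ₗ⋆[ℂ] K} (hΓ : IsAntilinearInvolution Γ)
    {Lφ Lπ : Submodule ℂ K} [Lφ.HasOrthogonalProjection] [Lπ.HasOrthogonalProjection]
    (hLφ : ∀ ψ ∈ Lφ, Γ ψ ∈ Lφ) (hLπ : ∀ ψ ∈ Lπ, Γ ψ ∈ Lπ) (l : List K) :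
    ∀ A ∈ fieldAlgebra (realSubspace Γ Lφ Lπ), ‖⟪wedge l, A (vacuum K)⟫_ℂ‖
      ≤ (l.map fun ψ => ‖Lφ.starProjection ψ - Lπ.starProjection ψ‖
        + ‖Lφ.starProjection ψ + Lπ.starProjection ψ‖).prod * ‖A‖ := by
  induction l with
  | nil =>
    intro A _
    rw [wedge_nil, List.map_nil, List.prod_nil, one_mul]
    refine (norm_inner_le_norm _ _).trans ?_
    rw [norm_vacuum, one_mul]
    simpa [norm_vacuum] using A.le_opNorm (vacuum K)
  | cons ψ l ih =>
    intro A hA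
    obtain ⟨B, hB, hAB, hnorm⟩ := exists_annihilation_eq hΓ hLφ hLπ ψ hA
    rw [wedge_cons, ← ContinuousLinearMap.adjoint_inner_right, ← annihilation, hAB,
      List.map_cons, List.prod_cons]
    refine (ih B hB).trans ?_
    have hp : 0 ≤ (l.map fun ψ => ‖Lφ.starProjection ψ - Lπ.starProjection ψ‖
        + ‖Lφ.starProjection ψ + Lπ.starProjection ψ‖).prod :=
      List.prod_nonneg (by simp only [List.mem_map]; rintro _ ⟨ψ, -, rfl⟩; positivity)
    calc _ ≤ _ := mul_le_mul_of_nonneg_left hnorm hp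
      _ = _ := by ring

theorem norm_inner_wedge_nuclearityMap_le {Γ : K →ₗ⋆[ℂ] K} (hΓ : IsAntilinearInvolution Γ)
    {Lφ Lπ : Submodule ℂ K} [Lφ.HasOrthogonalProjection] [Lπ.HasOrthogonalProjection]
    (hLφ : ∀ ψ ∈ Lφ, Γ ψ ∈ Lφ) (hLπ : ∀ ψ ∈ Lπ, Γ ψ ∈ Lπ)
    {X : K →ₗ.[ℂ] K} (hX : IsStrictlyPositiveOp X)
    (hdom : ∀ A ∈ fieldAlgebra (realSubspace Γ Lφ Lπ),
      A (vacuum K) ∈ (secondQuantization X).domain)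
    {Tφ Tπ : K →L[ℂ] K}
    (hTφ : ∀ ψ : X.domain, Tφ ψ = Lφ.starProjection (X ψ))
    (hTπ : ∀ ψ : X.domain, Tπ ψ = Lπ.starProjection (X ψ))
    (l : List K) (A : (fieldAlgebra (realSubspace Γ Lφ Lπ)).toStarSubalgebra) :
    ‖⟪wedge l, nuclearityMap X _ hdom A⟫_ℂ‖
      ≤ (l.map fun ξ => ‖Tφ ξ - Tπ ξ‖ + ‖Tφ ξ + Tπ ξ‖).prod * ‖A‖ := by
  suffices h : ∀ (n : ℕ) (ξ : Fin n → K), ‖⟪wedge (List.ofFn ξ), nuclearityMap X _ hdom A⟫_ℂ‖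
      ≤ (∏ i, (‖Tφ (ξ i) - Tπ (ξ i)‖ + ‖Tφ (ξ i) + Tπ (ξ i)‖)) * ‖A‖ by
    have := h l.length l.get
    rwa [← List.prod_ofFn, ← Function.comp_def (fun ξ => ‖Tφ ξ - Tπ ξ‖ + ‖Tφ ξ + Tπ ξ‖) l.get,
      ← List.map_ofFn, List.ofFn_get] at this
  intro n ξ
  have hclosed : IsClosed {ξ : Fin n → K | ‖⟪wedge (List.ofFn ξ), nuclearityMap X _ hdom A⟫_ℂ‖
      ≤ (∏ i, (‖Tφ (ξ i) - Tπ (ξ i)‖ + ‖Tφ (ξ i) + Tπ (ξ i)‖)) * ‖A‖} := by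
    have := continuous_wedge_ofFn (K := K) n
    exact isClosed_le (by fun_prop) (by fun_prop)
  have hdense : Dense (Set.univ.pi fun _ : Fin n => (X.domain : Set K)) :=
    dense_pi _ fun _ _ => hX.1
  -- Both sides are continuous in `ξ`, because `Tφ` and `Tπ` are bounded, so factors in `dom X`
  -- suffice; there `X` can be moved onto the wedge.
  refine closure_minimal (fun ξ hξ => ?_) hclosed (hdense ξ)
  simp only [Set.mem_pi, Set.mem_univ, true_implies, SetLike.mem_coe] at hξ
  let ζ : Fin n → X.domain := fun i => ⟨ξ i, hξ i⟩
  have h1 : List.ofFn ξ = (List.ofFn ζ).map X.domain.subtype := by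
    rw [List.map_ofFn]
    rfl
  change ‖⟪wedge (List.ofFn ξ), secondQuantization X ⟨A.1 (vacuum K), hdom A A.2⟩⟫_ℂ‖ ≤ _
  rw [h1, inner_wedge_secondQuantization hX]
  refine (norm_inner_wedge_le hΓ hLφ hLπ _ A.1 A.2).trans (le_of_eq ?_)
  congr 1
  rw [List.map_map, List.map_ofFn, List.prod_ofFn]
  refine Finset.prod_congr rfl fun i _ => ?_
  have h2 := hTφ (ζ i)
  have h3 := hTπ (ζ i)
  change Tφ (ξ i) = _ at h2
  change Tπ (ξ i) = _ at h3
  rw [h2, h3]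
  rfl

end CoefficientBound

/-! ### Hilbert-Schmidt sums and compactness -/

section HilbertSchmidt

open scoped ENNReal

variable {K : Type*} [NormedAddCommGroup K] [InnerProductSpace ℂ K]

theorem hasSum_norm_inner_sq {ι : Type*} (b : HilbertBasis ι ℂ K) (x : K) :
    HasSum (fun i => ‖⟪b i, x⟫_ℂ‖ ^ 2) (‖x‖ ^ 2) := by
  have h := Complex.hasSum_re (b.hasSum_inner_mul_inner x x)
  have h2 : (⟪x, x⟫_ℂ).re = ‖x‖ ^ 2 := inner_self_eq_norm_sq (𝕜 := ℂ) x
  rw [h2] at h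
  refine h.congr_fun fun i => ?_
  rw [← inner_conj_symm x (b i), ← Complex.normSq_eq_conj_mul_self, Complex.ofReal_re,
    Complex.normSq_eq_norm_sq]

theorem tsum_enorm_inner_sq {ι : Type*} (b : HilbertBasis ι ℂ K) (x : K) :
    ∑' i, ‖⟪b i, x⟫_ℂ‖ₑ ^ 2 = ‖x‖ₑ ^ 2 := by
  have h := hasSum_norm_inner_sq b x
  have := ENNReal.ofReal_tsum_of_nonneg (fun i => sq_nonneg ‖⟪b i, x⟫_ℂ‖) h.summable
  rw [h.tsum_eq] at this
  simpa [ENNReal.ofReal_pow, ofReal_norm] using this.symm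

variable [CompleteSpace K]

/-- Parseval in both bases and interchange of the sums; extended nonnegative values make summability
hypotheses unnecessary. -/
theorem tsum_enorm_sq_adjoint {ι κ : Type*} (b : HilbertBasis ι ℂ K) (c : HilbertBasis κ ℂ K)
    (S : K →L[ℂ] K) :
    ∑' i, ‖S (b i)‖ₑ ^ 2 = ∑' j, ‖S.adjoint (c j)‖ₑ ^ 2 := by
  have h1 : ∀ i, ‖S (b i)‖ₑ ^ 2 = _ := fun i => (tsum_enorm_inner_sq c (S (b i))).symm
  have h2 : ∀ j, ‖S.adjoint (c j)‖ₑ ^ 2 = _ := fun j => (tsum_enorm_inner_sq b _).symm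
  rw [tsum_congr h1, tsum_congr h2]
  rw [ENNReal.tsum_comm]
  refine tsum_congr fun j => tsum_congr fun i => ?_
  rw [ContinuousLinearMap.adjoint_inner_right, ← ofReal_norm, norm_inner_symm, ofReal_norm]

theorem tsum_enorm_sq_eq {ι κ : Type*} (b : HilbertBasis ι ℂ K) (c : HilbertBasis κ ℂ K)
    (S : K →L[ℂ] K) : ∑' i, ‖S (b i)‖ₑ ^ 2 = ∑' j, ‖S (c j)‖ₑ ^ 2 := by
  rw [tsum_enorm_sq_adjoint b b, tsum_enorm_sq_adjoint b c, ContinuousLinearMap.adjoint_adjoint]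

/-- Right multiplication by a contraction does not increase the Hilbert-Schmidt norm. -/
theorem tsum_enorm_sq_comp_le {ι : Type*} (b : HilbertBasis ι ℂ K) (S C : K →L[ℂ] K)
    (hC : ‖C‖ ≤ 1) : ∑' i, ‖S (C (b i))‖ₑ ^ 2 ≤ ∑' i, ‖S (b i)‖ₑ ^ 2 := by
  change ∑' i, ‖(S ∘L C) (b i)‖ₑ ^ 2 ≤ _
  rw [tsum_enorm_sq_adjoint b b (S ∘L C), tsum_enorm_sq_adjoint b b S]
  refine ENNReal.tsum_le_tsum fun i => ?_
  gcongr
  rw [ContinuousLinearMap.adjoint_comp, ContinuousLinearMap.comp_apply, enorm_le_iff_norm_le]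
  refine (C.adjoint.le_opNorm _).trans ?_
  rw [LinearIsometryEquiv.norm_map]
  exact mul_le_of_le_one_left (norm_nonneg _) hC

theorem norm_le_sqrt_tsum_norm_sq {ι : Type*} (b : HilbertBasis ι ℂ K) (R : K →L[ℂ] K)
    (h : Summable fun i => ‖R (b i)‖ ^ 2) : ‖R‖ ≤ √(∑' i, ‖R (b i)‖ ^ 2) := by
  rw [← LinearIsometryEquiv.norm_map ContinuousLinearMap.adjoint R]
  refine ContinuousLinearMap.opNorm_le_bound _ (Real.sqrt_nonneg _) fun x => ?_
  rw [← Real.sqrt_sq (norm_nonneg x), ← Real.sqrt_mul (tsum_nonneg fun _ => sq_nonneg _)]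
  refine Real.le_sqrt_of_sq_le ?_
  rw [← (hasSum_norm_inner_sq b (R.adjoint x)).tsum_eq, ← tsum_mul_right]
  refine (hasSum_norm_inner_sq b _).summable.tsum_le_tsum (fun i => ?_) (h.mul_right _)
  rw [ContinuousLinearMap.adjoint_inner_right, ← mul_pow]
  gcongr
  exact norm_inner_le_norm _ _

/-- The finite rank truncations `F s` converge to `S` in norm: the error vanishes on `b i` for `i ∈
s`, and its Hilbert-Schmidt norm is the root of a tail of a convergent series. -/
theorem isCompactOperator_of_summable {ι : Type*} (b : HilbertBasis ι ℂ K) (S : K →L[ℂ] K)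
    (h : Summable fun i => ‖S (b i)‖ ^ 2) : IsCompactOperator S := by
  classical
  let F : Finset ι → K →L[ℂ] K := fun s => ∑ i ∈ s, (innerSL ℂ (b i)).smulRight (S (b i))
  have hF : ∀ s, IsCompactOperator (F s) := by
    intro s
    have : F s ∈ compactOperator (RingHom.id ℂ) K K := by
      refine Submodule.sum_mem _ fun i _ => ?_
      have h1 : IsCompactOperator (ContinuousLinearMap.toSpanSingleton ℂ (S (b i))) :=
        isCompactOperator_of_locallyCompactSpace_rng _
      exact h1.comp_clm (innerSL ℂ (b i))
    exact this
  have hbound : ∀ s, ‖F s - S‖ ≤ √(∑' i : {i // i ∉ s}, ‖S (b i)‖ ^ 2) := by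
    intro s
    have hR : ∀ i, (F s - S) (b i) = if i ∈ s then 0 else -S (b i) := by
      intro i
      have hi := orthonormal_iff_ite.1 b.orthonormal
      simp only [F, sub_apply, sum_apply, ContinuousLinearMap.smulRight_apply, innerSL_apply_apply,
        hi, ite_smul, one_smul, zero_smul, Finset.sum_ite_eq']
      split_ifs <;> simp
    have hind : ∀ i, ‖(F s - S) (b i)‖ ^ 2
        = Set.indicator {i | i ∉ s} (fun i => ‖S (b i)‖ ^ 2) i := by
      intro i
      rw [hR]
      by_cases hi : i ∈ s <;> simp [hi]
    have hsum : Summable fun i => ‖(F s - S) (b i)‖ ^ 2 := by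
      simp_rw [hind]
      exact h.indicator _
    have htsum : ∑' i, ‖(F s - S) (b i)‖ ^ 2 = ∑' i : {i // i ∉ s}, ‖S (b i)‖ ^ 2 := by
      simp_rw [hind]
      exact (tsum_subtype {i | i ∉ s} fun i => ‖S (b i)‖ ^ 2).symm
    rw [← htsum]
    exact norm_le_sqrt_tsum_norm_sq b _ hsum
  refine isCompactOperator_of_tendsto (l := Filter.atTop) (F := F) ?_
    (Filter.Eventually.of_forall hF)
  rw [tendsto_iff_norm_sub_tendsto_zero]
  refine squeeze_zero (fun _ => norm_nonneg _) hbound ?_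
  have := (tendsto_tsum_compl_atTop_zero fun i => ‖S (b i)‖ ^ 2)
  have h0 := (Real.continuous_sqrt.tendsto 0).comp this
  rwa [Real.sqrt_zero] at h0

end HilbertSchmidt

/-! ### Traces of positive operators and subadditivity -/

section Trace

open scoped ENNReal

variable {K : Type*} [NormedAddCommGroup K] [InnerProductSpace ℂ K] [CompleteSpace K]

theorem hasSum_iff_tsum_ofReal {ι : Type*} {f : ι → ℝ} (hf : ∀ i, 0 ≤ f i) {a : ℝ} (ha : 0 ≤ a) :
    HasSum f a ↔ ∑' i, ENNReal.ofReal (f i) = ENNReal.ofReal a := by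
  constructor
  · intro h
    rw [← ENNReal.ofReal_tsum_of_nonneg hf h.summable, h.tsum_eq]
  · intro h
    have hs : Summable f := by
      have := ENNReal.summable_toReal (h.trans_ne ENNReal.ofReal_ne_top)
      simpa [ENNReal.toReal_ofReal, hf] using this
    rw [← ENNReal.ofReal_tsum_of_nonneg hf hs,
      ENNReal.ofReal_eq_ofReal_iff (tsum_nonneg hf) ha] at h
    exact h ▸ hs.hasSum

theorem inner_eq_inner_sqrt {A : K →L[ℂ] K} (hA : 0 ≤ A) (x y : K) :
    ⟪x, A y⟫_ℂ = ⟪CFC.sqrt A x, CFC.sqrt A y⟫_ℂ := by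
  have h : IsSelfAdjoint (CFC.sqrt A) := (CFC.sqrt_nonneg A).isSelfAdjoint
  rw [← ContinuousLinearMap.adjoint_inner_right, h.adjoint_eq]
  nth_rewrite 1 [← CFC.sqrt_mul_sqrt_self A hA]
  rfl

theorem re_inner_eq_norm_sqrt_sq {A : K →L[ℂ] K} (hA : 0 ≤ A) (x : K) :
    (⟪x, A x⟫_ℂ).re = ‖CFC.sqrt A x‖ ^ 2 := by
  rw [inner_eq_inner_sqrt hA]
  exact inner_self_eq_norm_sq (𝕜 := ℂ) _

theorem ofReal_re_inner {A : K →L[ℂ] K} (hA : 0 ≤ A) (x : K) :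
    ENNReal.ofReal (⟪x, A x⟫_ℂ).re = ‖CFC.sqrt A x‖ₑ ^ 2 := by
  rw [re_inner_eq_norm_sqrt_sq hA, ENNReal.ofReal_pow (norm_nonneg _), ofReal_norm]

theorem re_inner_nonneg_of_nonneg {A : K →L[ℂ] K} (hA : 0 ≤ A) (x : K) :
    0 ≤ (⟪x, A x⟫_ℂ).re := by
  rw [re_inner_eq_norm_sqrt_sq hA]
  positivity

/-- The trace of a positive operator does not depend on the orthonormal basis. -/
theorem hasSum_trace_of_hasSum_trace {ι κ : Type*} (b : HilbertBasis ι ℂ K)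
    (c : HilbertBasis κ ℂ K) {A : K →L[ℂ] K} (hA : 0 ≤ A) {a : ℝ}
    (h : HasSum (fun i => (⟪b i, A (b i)⟫_ℂ).re) a) :
    HasSum (fun j => (⟪c j, A (c j)⟫_ℂ).re) a := by
  have ha : 0 ≤ a := h.nonneg fun i => re_inner_nonneg_of_nonneg hA _
  rw [hasSum_iff_tsum_ofReal (fun _ => re_inner_nonneg_of_nonneg hA _) ha] at h ⊢
  simp_rw [ofReal_re_inner hA] at h ⊢
  rw [← h, tsum_enorm_sq_eq]

theorem isCompactOperator_of_summable_trace {ι : Type*} (b : HilbertBasis ι ℂ K)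
    {A : K →L[ℂ] K} (hA : 0 ≤ A) (h : Summable fun i => (⟪b i, A (b i)⟫_ℂ).re) :
    IsCompactOperator A := by
  simp_rw [re_inner_eq_norm_sqrt_sq hA] at h
  have := (isCompactOperator_of_summable b _ h).clm_comp (CFC.sqrt A)
  rw [← CFC.sqrt_mul_sqrt_self A hA]
  exact this

/-- Douglas factorization. -/
theorem exists_contraction_comp_eq {A T : K →L[ℂ] K} (h : ∀ x, ‖A x‖ ≤ ‖T x‖) :
    ∃ C : K →L[ℂ] K, ‖C‖ ≤ 1 ∧ (∀ x, C (T x) = A x) ∧ ∀ x ∈ T.rangeᗮ, C x = 0 := by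
  let M := T.range.topologicalClosure
  have hM : ∀ x, T x ∈ M := fun x => T.range.le_topologicalClosure ⟨x, rfl⟩
  let e : K →ₗ[ℂ] M := T.toLinearMap.codRestrict M hM
  have hdense : DenseRange e := by
    rw [DenseRange, Subtype.dense_iff]
    intro x hx
    refine closure_mono ?_ hx
    rintro _ ⟨y, rfl⟩
    exact ⟨e y, ⟨y, rfl⟩, rfl⟩
  have hnorm : ∀ x, ‖A.toLinearMap x‖ ≤ 1 * ‖e x‖ := fun x => by
    rw [one_mul]
    exact h x
  -- The assignment `T x ↦ A x` is contractive on the range of `T`; it is extended to the closure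
  -- and by zero to the orthogonal complement.
  refine ⟨(A.toLinearMap.extendOfNorm e) ∘L M.orthogonalProjectionOnto, ?_, fun x => ?_,
    fun x hx => ?_⟩
  · refine (ContinuousLinearMap.opNorm_comp_le _ _).trans (mul_le_one₀ ?_ (norm_nonneg _) ?_)
    · exact LinearMap.opNorm_extendOfNorm_le hdense zero_le_one hnorm
    · exact M.orthogonalProjectionOnto_norm_le
  · have h1 : M.orthogonalProjectionOnto (T x) = e x :=
      M.orthogonalProjectionOnto_mem_subspace_eq_self ⟨T x, hM x⟩
    rw [ContinuousLinearMap.comp_apply, h1]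
    exact LinearMap.extendOfNorm_eq hdense ⟨1, hnorm⟩ x
  · have h1 : x ∈ Mᗮ := by rwa [Submodule.orthogonal_closure]
    rw [ContinuousLinearMap.comp_apply,
      Submodule.orthogonalProjectionOnto_eq_zero_iff.2 h1, map_zero]

/-- The bound `|Tr C*A| ≤ Tr A`: split `A` into square roots and use `2xy ≤ x² + y²`. Both square
sums are at most `Tr A`, since right multiplication by `C` does not increase the Hilbert-Schmidt
norm. -/
theorem tsum_enorm_inner_contraction_le {ι : Type*} (b : HilbertBasis ι ℂ K)
    {A C : K →L[ℂ] K} (hA : 0 ≤ A) (hC : ‖C‖ ≤ 1) :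
    ∑' i, ‖⟪C (b i), A (b i)⟫_ℂ‖ₑ ≤ ∑' i, ENNReal.ofReal (⟪b i, A (b i)⟫_ℂ).re := by
  have h1 : ∀ i, 2 * ‖⟪C (b i), A (b i)⟫_ℂ‖ₑ
      ≤ ‖CFC.sqrt A (C (b i))‖ₑ ^ 2 + ‖CFC.sqrt A (b i)‖ₑ ^ 2 := by
    intro i
    rw [inner_eq_inner_sqrt hA]
    have h2 := norm_inner_le_norm (𝕜 := ℂ) (CFC.sqrt A (C (b i))) (CFC.sqrt A (b i))
    have h3 := two_mul_le_add_sq ‖CFC.sqrt A (C (b i))‖ ‖CFC.sqrt A (b i)‖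
    have h4 := ENNReal.ofReal_le_ofReal
      (show 2 * ‖⟪CFC.sqrt A (C (b i)), CFC.sqrt A (b i)⟫_ℂ‖
        ≤ ‖CFC.sqrt A (C (b i))‖ ^ 2 + ‖CFC.sqrt A (b i)‖ ^ 2 by linarith)
    rw [ENNReal.ofReal_mul zero_le_two, ENNReal.ofReal_add (by positivity) (by positivity),
      ENNReal.ofReal_pow (norm_nonneg _), ENNReal.ofReal_pow (norm_nonneg _)] at h4
    simpa only [ofReal_norm, ENNReal.ofReal_ofNat] using h4
  simp_rw [ofReal_re_inner hA]
  have h2 := ENNReal.tsum_le_tsum h1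
  rw [ENNReal.tsum_mul_left, ENNReal.tsum_add] at h2
  have h3 := h2.trans (add_le_add_left (tsum_enorm_sq_comp_le b (CFC.sqrt A) C hC) _)
  rw [← two_mul] at h3
  exact (ENNReal.mul_le_mul_iff_right two_ne_zero ENNReal.ofNat_ne_top).1 h3

theorem inner_map_map_of_mul_self_eq {A B T : K →L[ℂ] K} (hA : 0 ≤ A) (hB : 0 ≤ B) (hT : 0 ≤ T)
    (h : T * T = A * A + B * B) (x y : K) :
    ⟪T x, T y⟫_ℂ = ⟪A x, A y⟫_ℂ + ⟪B x, B y⟫_ℂ := by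
  have key : ∀ {S : K →L[ℂ] K}, 0 ≤ S → ⟪S x, S y⟫_ℂ = ⟪x, (S * S) y⟫_ℂ := fun {S} hS => by
    rw [← ContinuousLinearMap.adjoint_inner_right, hS.isSelfAdjoint.adjoint_eq]
    rfl
  rw [key hA, key hB, key hT, h, add_apply, inner_add_right]

/-- `Tr T ≤ Tr A + Tr B` for positive operators with `T² = A² + B²`. -/
theorem summable_trace_and_tsum_le {ι : Type*} (b : HilbertBasis ι ℂ K) {A B T : K →L[ℂ] K}
    (hA : 0 ≤ A) (hB : 0 ≤ B) (hT : 0 ≤ T) (h : T * T = A * A + B * B)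
    (hAs : Summable fun i => (⟪b i, A (b i)⟫_ℂ).re)
    (hBs : Summable fun i => (⟪b i, B (b i)⟫_ℂ).re) :
    Summable (fun i => (⟪b i, T (b i)⟫_ℂ).re) ∧
    ∑' i, (⟪b i, T (b i)⟫_ℂ).re
      ≤ ∑' i, (⟪b i, A (b i)⟫_ℂ).re + ∑' i, (⟪b i, B (b i)⟫_ℂ).re := by
  have hin := inner_map_map_of_mul_self_eq hA hB hT h
  have hnorm : ∀ x, ‖T x‖ ^ 2 = ‖A x‖ ^ 2 + ‖B x‖ ^ 2 := fun x => by
    have := congrArg Complex.re (hin x x)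
    rw [Complex.add_re] at this
    rw [← inner_self_eq_norm_sq (𝕜 := ℂ), ← inner_self_eq_norm_sq (𝕜 := ℂ),
      ← inner_self_eq_norm_sq (𝕜 := ℂ)]
    exact this
  obtain ⟨C, hC1, hC2, hC3⟩ := exists_contraction_comp_eq (A := A) (T := T) fun x =>
    (sq_le_sq₀ (norm_nonneg _) (norm_nonneg _)).1 (by rw [hnorm]; linarith [sq_nonneg ‖B x‖])
  obtain ⟨D, hD1, hD2, hD3⟩ := exists_contraction_comp_eq (A := B) (T := T) fun x =>
    (sq_le_sq₀ (norm_nonneg _) (norm_nonneg _)).1 (by rw [hnorm]; linarith [sq_nonneg ‖A x‖])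
  -- Weak form of `T = C*A + D*B`. For `x` in the range of `T` it is `T² = A² + B²`; for `x`
  -- orthogonal to the range both sides vanish.
  have hfac : ∀ x y, ⟪x, T y⟫_ℂ = ⟪C x, A y⟫_ℂ + ⟪D x, B y⟫_ℂ := by
    intro x y
    have hclosed : IsClosed {x | ⟪x, T y⟫_ℂ = ⟪C x, A y⟫_ℂ + ⟪D x, B y⟫_ℂ} :=
      isClosed_eq (by fun_prop) (by fun_prop)
    have hM : ∀ x ∈ T.range.topologicalClosure, ⟪x, T y⟫_ℂ = ⟪C x, A y⟫_ℂ + ⟪D x, B y⟫_ℂ := by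
      intro x hx
      refine closure_minimal ?_ hclosed hx
      rintro _ ⟨z, rfl⟩
      change ⟪T z, T y⟫_ℂ = ⟪C (T z), A y⟫_ℂ + ⟪D (T z), B y⟫_ℂ
      rw [hC2, hD2, hin]
    obtain ⟨m, hm, n, hn, rfl⟩ :=
      T.range.topologicalClosure.exists_add_mem_mem_orthogonal x
    rw [Submodule.orthogonal_closure] at hn
    have hnT : ⟪n, T y⟫_ℂ = 0 := Submodule.inner_left_of_mem_orthogonal (K := T.range) ⟨y, rfl⟩ hn
    rw [map_add, map_add, hC3 n hn, hD3 n hn, add_zero, add_zero, inner_add_left, hM m hm,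
      hnT, add_zero]
  have hle : ∑' i, ENNReal.ofReal (⟪b i, T (b i)⟫_ℂ).re
      ≤ ENNReal.ofReal (∑' i, (⟪b i, A (b i)⟫_ℂ).re + ∑' i, (⟪b i, B (b i)⟫_ℂ).re) := by
    rw [ENNReal.ofReal_add (tsum_nonneg fun _ => re_inner_nonneg_of_nonneg hA _)
      (tsum_nonneg fun _ => re_inner_nonneg_of_nonneg hB _),
      ENNReal.ofReal_tsum_of_nonneg (fun _ => re_inner_nonneg_of_nonneg hA _) hAs,
      ENNReal.ofReal_tsum_of_nonneg (fun _ => re_inner_nonneg_of_nonneg hB _) hBs]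
    refine le_trans ?_ (add_le_add (tsum_enorm_inner_contraction_le b hA hC1)
      (tsum_enorm_inner_contraction_le b hB hD1))
    rw [← ENNReal.tsum_add]
    refine ENNReal.tsum_le_tsum fun i => ?_
    refine (ENNReal.ofReal_le_ofReal (Complex.re_le_norm _)).trans ?_
    rw [ofReal_norm, hfac]
    exact enorm_add_le _ _
  have hs : Summable (fun i => (⟪b i, T (b i)⟫_ℂ).re) := by
    have := ENNReal.summable_toReal (ne_top_of_le_ne_top ENNReal.ofReal_ne_top hle)
    simpa [ENNReal.toReal_ofReal, re_inner_nonneg_of_nonneg hT] using this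
  refine ⟨hs, ?_⟩
  rw [← ENNReal.ofReal_tsum_of_nonneg (fun _ => re_inner_nonneg_of_nonneg hT _) hs] at hle
  exact (ENNReal.ofReal_le_ofReal_iff (add_nonneg
    (tsum_nonneg fun _ => re_inner_nonneg_of_nonneg hA _)
    (tsum_nonneg fun _ => re_inner_nonneg_of_nonneg hB _))).1 hle

end Trace

/-! ### Eigenbases and the determinant -/

section Eigenbasis

variable {K : Type u} [NormedAddCommGroup K] [InnerProductSpace ℂ K] [CompleteSpace K]

/-- Bases of all eigenspaces are joined, including the possibly infinite-dimensional kernel.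
Indexing by pairs of an eigenvalue and a basis vector makes the fibre sizes match the exponents in
`detOneAdd`. -/
theorem exists_eigenbasis {S : K →L[ℂ] K} (hS : 0 ≤ S) (hc : IsCompactOperator S) :
    ∃ (w : ∀ s : ℝ, Set (Module.End.eigenspace (S : K →ₗ[ℂ] K) (s : ℂ)))
      (b : HilbertBasis (Σ s : ℝ, w s) ℂ K),
      (∀ j, S (b j) = (j.1 : ℂ) • b j) ∧
      ∀ s : ℝ, s ≠ 0 → ∃ _ : Fintype (w s), Fintype.card (w s)
        = Module.finrank ℂ (Module.End.eigenspace (S : K →ₗ[ℂ] K) (s : ℂ)) := by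
  have hsymm : (S : K →ₗ[ℂ] K).IsSymmetric := hS.isSelfAdjoint.isSymmetric
  have hcompl : ∀ s : ℝ, CompleteSpace (Module.End.eigenspace (S : K →ₗ[ℂ] K) (s : ℂ)) := by
    intro s
    refine IsComplete.completeSpace_coe (IsClosed.isComplete ?_)
    have : (Module.End.eigenspace (S : K →ₗ[ℂ] K) (s : ℂ) : Set K) = {x | S x = (s : ℂ) • x} := by
      ext x
      simp
    rw [this]
    exact isClosed_eq (by fun_prop) (by fun_prop)
  have hex := fun s : ℝ =>
    exists_hilbertBasis ℂ (Module.End.eigenspace (S : K →ₗ[ℂ] K) (s : ℂ))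
  choose w e he using hex
  have hfam : OrthogonalFamily ℂ
      (fun s : ℝ => Module.End.eigenspace (S : K →ₗ[ℂ] K) (s : ℂ))
      (fun s => (Module.End.eigenspace (S : K →ₗ[ℂ] K) (s : ℂ)).subtypeₗᵢ) :=
    hsymm.orthogonalFamily_eigenspaces.comp Complex.ofReal_injective
  have hon := hfam.orthonormal_sigma_orthonormal (fun s => (e s).orthonormal)
  have hspan : (Submodule.span ℂ (Set.range fun a : Σ s : ℝ, w s =>
      (Module.End.eigenspace (S : K →ₗ[ℂ] K) (a.1 : ℂ)).subtypeₗᵢ (e a.1 a.2)))ᗮ = ⊥ := by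
    rw [eq_bot_iff, ← ContinuousLinearMap.orthogonalComplement_iSup_eigenspaces_eq_bot hc hsymm]
    intro x hx
    rw [Submodule.mem_orthogonal] at hx
    suffices hle : ⨆ μ, Module.End.eigenspace (S : K →ₗ[ℂ] K) μ ≤ (ℂ ∙ x)ᗮ from
      (Submodule.mem_orthogonal' _ _).2 fun y hy =>
        Submodule.mem_orthogonal_singleton_iff_inner_right.1 (hle hy)
    refine iSup_le fun μ y hy => Submodule.mem_orthogonal_singleton_iff_inner_right.2 ?_
    by_cases hy0 : y = 0
    · simp [hy0]
    have hμ : ((μ.re : ℝ) : ℂ) = μ := Complex.conj_eq_iff_re.1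
      (hsymm.conj_eigenvalue_eq_self (Module.End.hasEigenvalue_of_hasEigenvector ⟨hy, hy0⟩))
    rw [← hμ] at hy
    have h1 := ((e μ.re).hasSum_repr ⟨y, hy⟩).mapL
      ((innerSL ℂ x) ∘L (Module.End.eigenspace (S : K →ₗ[ℂ] K) ((μ.re : ℝ) : ℂ)).subtypeL)
    have h2 : ∀ i, ⟪x, ((e μ.re i : Module.End.eigenspace (S : K →ₗ[ℂ] K) ((μ.re : ℝ) : ℂ)) : K)⟫_ℂ
        = 0 := fun i => by
      have h3 := hx _ (Submodule.subset_span ⟨⟨μ.re, i⟩, rfl⟩)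
      exact inner_eq_zero_symm.1 h3
    refine h1.unique ?_
    simp [h2, hasSum_zero]
  refine ⟨w, HilbertBasis.mkOfOrthogonalEqBot hon hspan, fun j => ?_, fun s hs => ?_⟩
  · rw [HilbertBasis.coe_mkOfOrthogonalEqBot]
    exact Module.End.mem_eigenspace_iff.1 (e j.1 j.2).2
  · have := ContinuousLinearMap.finite_dimensional_eigenspace hc (s : ℂ) (by exact_mod_cast hs)
    have hfin : Finite (w s) := (e s).orthonormal.linearIndependent.finite
    have := Fintype.ofFinite (w s)
    refine ⟨this, ?_⟩
    rw [Module.finrank_eq_card_basis (e s).toOrthonormalBasis.toBasis]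

/-- Diagonalization of a positive trace class operator, with its determinant as a product over the
eigenbasis. -/
theorem exists_eigenbasis_detOneAdd {S : K →L[ℂ] K} (hS : 0 ≤ S) {κ : Type*}
    (c : HilbertBasis κ ℂ K) {a : ℝ} (h : HasSum (fun i => (⟪c i, S (c i)⟫_ℂ).re) a) :
    ∃ (J : Type u) (b : HilbertBasis J ℂ K) (σ : J → ℝ), (∀ j, 0 ≤ σ j) ∧
      (∀ j, S (b j) = (σ j : ℂ) • b j) ∧ HasSum σ a ∧ detOneAdd S = ∏' j, (1 + σ j) := by
  obtain ⟨w, b, hb, hw⟩ :=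
    exists_eigenbasis hS (isCompactOperator_of_summable_trace c hS h.summable)
  have hσ : ∀ j, (⟪b j, S (b j)⟫_ℂ).re = j.1 := fun j => by
    rw [hb, inner_smul_right, inner_self_eq_norm_sq_to_K, b.orthonormal.1]
    simp
  have hpos : ∀ j : Σ s : ℝ, w s, 0 ≤ j.1 := fun j => hσ j ▸ re_inner_nonneg_of_nonneg hS _
  have hsum : HasSum (fun j : Σ s : ℝ, w s => j.1) a := by
    simpa only [hσ] using hasSum_trace_of_hasSum_trace c b hS h
  refine ⟨_, b, fun j => j.1, hpos, hb, hsum, ?_⟩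
  have hmul : Multipliable fun j : Σ s : ℝ, w s => 1 + j.1 :=
    Real.multipliable_one_add_of_summable hsum.summable
  have hfib : ∀ s : ℝ, HasProd (fun _ : w s => 1 + s)
      ((1 + s) ^ Module.finrank ℂ (Module.End.eigenspace (S : K →ₗ[ℂ] K) (s : ℂ))) := by
    intro s
    -- The kernel contributes a product of ones whatever its dimension, so the value of `finrank`
    -- there does not matter.
    by_cases hs : s = 0
    · subst hs
      simp
    · obtain ⟨_, hcard⟩ := hw s hs
      have := hasProd_fintype fun _ : w s => 1 + s
      rwa [Finset.prod_const, Finset.card_univ, hcard] at this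
  rw [hmul.tprod_sigma' fun s => (hfib s).multipliable]
  exact tprod_congr fun s => (hfib s).tprod_eq.symm

theorem tprod_one_add_le_exp {J : Type*} {σ : J → ℝ} (hσ : ∀ j, 0 ≤ σ j) {a : ℝ}
    (h : HasSum σ a) : ∏' j, (1 + σ j) ≤ Real.exp a := by
  refine le_of_tendsto' (Real.multipliable_one_add_of_summable h.summable).hasProd fun s => ?_
  calc ∏ j ∈ s, (1 + σ j) ≤ ∏ j ∈ s, Real.exp (σ j) :=
        Finset.prod_le_prod (fun j _ => by linarith [hσ j])
          fun j _ => by linarith [Real.add_one_le_exp (σ j)]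
    _ = Real.exp (∑ j ∈ s, σ j) := (Real.exp_sum s σ).symm
    _ ≤ Real.exp a := Real.exp_le_exp.2 (sum_le_hasSum s (fun j _ => hσ j) h)

end Eigenbasis

/-! ### Orthonormal basis of Fock space -/

section FockBasis

variable {K : Type u} [NormedAddCommGroup K] [InnerProductSpace ℂ K]

theorem wedge_cons_cons_swap (ψ χ : K) (l : List K) :
    wedge (ψ :: χ :: l) = -wedge (χ :: ψ :: l) := by
  have h := congrArg (fun A : Fock K →L[ℂ] Fock K => A (wedge l)) (creation_mul_creation ψ χ)
  simp only [wedge_cons]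
  exact eq_neg_of_add_eq_zero_left h

theorem wedge_eq_or_eq_neg_of_perm {l l' : List K} (h : l.Perm l') :
    wedge l = wedge l' ∨ wedge l = -wedge l' := by
  induction h with
  | nil => exact Or.inl rfl
  | cons ψ _ ih =>
    rw [wedge_cons, wedge_cons]
    rcases ih with ih | ih <;> simp [ih]
  | swap ψ χ l => exact Or.inr (wedge_cons_cons_swap _ _ _)
  | trans _ _ ih ih' => rcases ih with ih | ih <;> rcases ih' with ih' | ih' <;> simp [ih, ih']

theorem wedge_cons_cons_self (ψ : K) (l : List K) : wedge (ψ :: ψ :: l) = 0 := by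
  have h : (2 : ℂ) • wedge (ψ :: ψ :: l) = 0 := by
    rw [two_smul]
    exact eq_neg_iff_add_eq_zero.1 (wedge_cons_cons_swap ψ ψ l)
  exact (smul_eq_zero.1 h).resolve_left two_ne_zero

theorem annihilation_creation_apply (ψ χ : K) (x : Fock K) :
    annihilation ψ (creation χ x) = ⟪ψ, χ⟫_ℂ • x - creation χ (annihilation ψ x) :=
  eq_sub_of_add_eq
    (congrArg (fun A : Fock K →L[ℂ] Fock K => A x) (annihilation_mul_creation ψ χ))

theorem annihilation_wedge_eq_zero (ψ : K) (l : List K) (h : ∀ χ ∈ l, ⟪ψ, χ⟫_ℂ = 0) :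
    annihilation ψ (wedge l) = 0 := by
  induction l with
  | nil => exact annihilation_vacuum ψ
  | cons χ l ih =>
    rw [wedge_cons, annihilation_creation_apply, h χ List.mem_cons_self,
      ih fun χ hχ => h χ (List.mem_cons_of_mem _ hχ)]
    simp

theorem inner_wedge_cons_left (ψ : K) (l : List K) (x : Fock K) :
    ⟪wedge (ψ :: l), x⟫_ℂ = ⟪wedge l, annihilation ψ x⟫_ℂ := by
  rw [wedge_cons, annihilation, ContinuousLinearMap.adjoint_inner_right]

variable {J : Type*} {b : J → K}

theorem inner_wedge_self_of_nodup (hb : Orthonormal ℂ b) {l : List J} (hl : l.Nodup) :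
    ⟪wedge (l.map b), wedge (l.map b)⟫_ℂ = 1 := by
  induction l with
  | nil =>
    rw [List.map_nil, wedge_nil, inner_self_eq_norm_sq_to_K, norm_vacuum]
    simp
  | cons j l ih =>
    obtain ⟨hj, hl⟩ := List.nodup_cons.1 hl
    rw [List.map_cons, inner_wedge_cons_left, wedge_cons, annihilation_creation_apply,
      annihilation_wedge_eq_zero, inner_self_eq_norm_sq_to_K, hb.1]
    · simpa using ih hl
    · simp only [List.mem_map]
      rintro _ ⟨k, hk, rfl⟩
      exact hb.2 fun h => hj (h ▸ hk)

/-- Up to sign `b j` can be moved to the front of `l`; then `a(b j)` annihilates the other wedge,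
all of whose factors are orthogonal to `b j`. -/
theorem inner_wedge_eq_zero_of_notMem (hb : Orthonormal ℂ b) {l l' : List J} {j : J}
    (hj : j ∈ l) (hj' : j ∉ l') : ⟪wedge (l.map b), wedge (l'.map b)⟫_ℂ = 0 := by
  classical
  have h0 : ⟪wedge ((j :: l.erase j).map b), wedge (l'.map b)⟫_ℂ = 0 := by
    rw [List.map_cons, inner_wedge_cons_left, annihilation_wedge_eq_zero, inner_zero_right]
    simp only [List.mem_map]
    rintro _ ⟨k, hk, rfl⟩
    exact hb.2 fun h => hj' (h ▸ hk)
  rcases wedge_eq_or_eq_neg_of_perm ((List.perm_cons_erase hj).map b) with h | h <;> rw [h]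
  · exact h0
  · rw [inner_neg_left, h0, neg_zero]

/-- The order chosen by `toList` is arbitrary; it affects each vector only by a sign. -/
theorem orthonormal_wedge (hb : Orthonormal ℂ b) :
    Orthonormal ℂ fun s : Finset J => wedge (s.toList.map b) := by
  classical
  rw [orthonormal_iff_ite]
  intro s t
  split_ifs with h
  · subst h
    exact inner_wedge_self_of_nodup hb s.nodup_toList
  · by_cases hst : s ⊆ t
    · obtain ⟨j, hj, hj'⟩ := Finset.not_subset.1 fun hts => h (hst.antisymm hts)
      rw [inner_eq_zero_symm]
      exact inner_wedge_eq_zero_of_notMem hb (Finset.mem_toList.2 hj)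
        (fun h => hj' (Finset.mem_toList.1 h))
    · obtain ⟨j, hj, hj'⟩ := Finset.not_subset.1 hst
      exact inner_wedge_eq_zero_of_notMem hb (Finset.mem_toList.2 hj)
        (fun h => hj' (Finset.mem_toList.1 h))

theorem wedge_map_mem_span (b : J → K) (l : List J) :
    wedge (l.map b) ∈ Submodule.span ℂ (Set.range fun s : Finset J => wedge (s.toList.map b)) := by
  classical
  by_cases hl : l.Nodup
  · have hmem : wedge (l.toFinset.toList.map b) ∈
        Submodule.span ℂ (Set.range fun s : Finset J => wedge (s.toList.map b)) :=
      Submodule.subset_span ⟨l.toFinset, rfl⟩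
    rcases wedge_eq_or_eq_neg_of_perm ((List.toFinset_toList hl).symm.map b) with h | h <;> rw [h]
    · exact hmem
    · exact neg_mem hmem
  · obtain ⟨j, hj⟩ := List.exists_duplicate_iff_not_nodup.2 hl
    obtain ⟨l', hl'⟩ := (List.duplicate_iff_sublist.1 hj).exists_perm_append
    have h0 : wedge (([j, j] ++ l').map b) = 0 := wedge_cons_cons_self (b j) (l'.map b)
    have : wedge (l.map b) = 0 := by
      rcases wedge_eq_or_eq_neg_of_perm (hl'.map b) with h | h <;> rw [h, h0]
      exact neg_zero
    rw [this]
    exact zero_mem _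

/-- The closed span contains the vacuum and is stable under creation by basis vectors, hence, by
continuity of `a*`, under all creation operators; these generate the exterior algebra from the
vacuum. -/
theorem top_le_closure_span_wedge (b : HilbertBasis J ℂ K) :
    ⊤ ≤ (Submodule.span ℂ
      (Set.range fun s : Finset J => wedge (s.toList.map b))).topologicalClosure := by
  set R := Submodule.span ℂ (Set.range fun s : Finset J => wedge (s.toList.map b)) with hR
  have hcreate : ∀ j, ∀ x ∈ R.topologicalClosure, creation (b j) x ∈ R.topologicalClosure := by
    intro j x hx
    have hm : Set.MapsTo (creation (b j)) (R : Set (Fock K)) R := by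
      intro y hy
      induction hy using Submodule.span_induction with
      | mem y hy =>
        obtain ⟨s, rfl⟩ := hy
        have := wedge_map_mem_span b (j :: s.toList)
        rwa [List.map_cons, wedge_cons] at this
      | zero => simp
      | add y z _ _ hy hz => rw [map_add]; exact R.add_mem hy hz
      | smul c y _ hy => rw [map_smul]; exact R.smul_mem c hy
    exact hm.closure (creation (b j)).continuous hx
  have hcreate' : ∀ ψ, ∀ x ∈ R.topologicalClosure, creation ψ x ∈ R.topologicalClosure := by
    intro ψ x hx
    have h := (b.hasSum_repr ψ).mapL (creationCLM.flip x)
    refine R.isClosed_topologicalClosure.mem_of_tendsto h (Filter.Eventually.of_forall fun s => ?_)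
    refine sum_mem fun j _ => ?_
    rw [map_smul]
    exact Submodule.smul_mem _ _ (hcreate j x hx)
  have hall : ∀ x : ExteriorAlgebra ℂ K, toFock x ∈ R.topologicalClosure := by
    intro x
    induction x using CliffordAlgebra.left_induction with
    | algebraMap c =>
      change toFock (algebraMap ℂ (ExteriorAlgebra ℂ K) c) ∈ _
      rw [Algebra.algebraMap_eq_smul_one, map_smul]
      exact Submodule.smul_mem _ _ (R.le_topologicalClosure (wedge_map_mem_span b []))
    | add x y hx hy => rw [map_add]; exact add_mem hx hy
    | ι_mul x u hx =>
      change toFock (ExteriorAlgebra.ι ℂ u * x) ∈ _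
      rw [← creation_toFock]
      exact hcreate' u _ hx
  intro z _
  exact denseRange_toFock.induction_on (p := fun z => z ∈ R.topologicalClosure) z
    R.isClosed_topologicalClosure hall

/-- The orthonormal basis of Fock space consisting of the wedge products of the finite subsets of an
orthonormal basis of `K`. -/
def fockBasis (b : HilbertBasis J ℂ K) : HilbertBasis (Finset J) ℂ (Fock K) :=
  HilbertBasis.mk (orthonormal_wedge b.orthonormal) (top_le_closure_span_wedge b)

theorem fockBasis_apply (b : HilbertBasis J ℂ K) (s : Finset J) :
    fockBasis b s = wedge (s.toList.map b) := by
  rw [fockBasis, HilbertBasis.coe_mk]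

end FockBasis

/-! ### Nuclear representations from orthonormal bases -/

section NuclearRep

variable {E F : Type*} [NormedAddCommGroup E] [NormedSpace ℂ E] [NormedAddCommGroup F]
  [NormedSpace ℂ F]

/-- An absolutely summable representation over an arbitrary index type can be reindexed by `ℕ`. -/
theorem exists_isNuclearRep {ι : Type*} {Ξ : E →ₗ[ℂ] F} (ρ : ι → StrongDual ℂ E) (Ψ : ι → F)
    (h : ∀ A, HasSum (fun i => ρ i A • Ψ i) (Ξ A)) (hs : Summable fun i => ‖ρ i‖ * ‖Ψ i‖) :
    ∃ ρ' Ψ', IsNuclearRep Ξ ρ' Ψ' ∧ ∑' k, ‖ρ' k‖ * ‖Ψ' k‖ = ∑' i, ‖ρ i‖ * ‖Ψ i‖ := by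
  -- A summable family has countable support, which embeds in `ℕ`; unused indices are filled with
  -- zero.
  set S := Function.support fun i => ‖ρ i‖ * ‖Ψ i‖ with hS
  have : Countable S := hs.countable_support
  obtain ⟨f, hf⟩ := exists_injective_nat S
  let ρ' : ℕ → StrongDual ℂ E := Function.extend f (fun i => ρ i) 0
  let Ψ' : ℕ → F := Function.extend f (fun i => Ψ i) 0
  have hterm : ∀ A, (fun k => ρ' k A • Ψ' k)
      = Function.extend f (fun i : S => ρ i A • Ψ i) 0 := by
    intro A
    funext k
    by_cases hk : ∃ i, f i = k
    · obtain ⟨i, rfl⟩ := hk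
      simp [ρ', Ψ', hf.extend_apply]
    · simp [ρ', Ψ', Function.extend_apply' _ _ _ hk]
  have hnorm : (fun k => ‖ρ' k‖ * ‖Ψ' k‖)
      = Function.extend f (fun i : S => ‖ρ i‖ * ‖Ψ i‖) 0 := by
    funext k
    by_cases hk : ∃ i, f i = k
    · obtain ⟨i, rfl⟩ := hk
      simp [ρ', Ψ', hf.extend_apply]
    · simp [ρ', Ψ', Function.extend_apply' _ _ _ hk]
  have hsum : HasSum (fun k => ‖ρ' k‖ * ‖Ψ' k‖) (∑' i, ‖ρ i‖ * ‖Ψ i‖) := by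
    rw [hnorm, hasSum_extend_zero hf]
    exact (hasSum_subtype_iff_of_support_subset subset_rfl).2 hs.hasSum
  refine ⟨ρ', Ψ', ⟨fun A => ?_, hsum.summable⟩, hsum.tsum_eq⟩
  rw [hterm, hasSum_extend_zero hf]
  refine (hasSum_subtype_iff_of_support_subset (f := fun i => ρ i A • Ψ i) fun i hi => ?_).2 (h A)
  simp only [Function.mem_support, ne_eq, smul_eq_zero, not_or] at hi
  have h1 : ρ i ≠ 0 := fun h => hi.1 (by simp [h])
  exact mul_ne_zero (norm_ne_zero_iff.2 h1) (norm_ne_zero_iff.2 hi.2)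

theorem nuclearNorm_le {Ξ : E →ₗ[ℂ] F} {ρ : ℕ → StrongDual ℂ E} {Ψ : ℕ → F}
    (h : IsNuclearRep Ξ ρ Ψ) : nuclearNorm Ξ ≤ ∑' k, ‖ρ k‖ * ‖Ψ k‖ := by
  refine csInf_le ⟨0, ?_⟩ ⟨ρ, Ψ, h, rfl⟩
  rintro _ ⟨ρ, Ψ, -, rfl⟩
  exact tsum_nonneg fun _ => by positivity

/-- A map into a Hilbert space is nuclear if its coefficients in some orthonormal basis are bounded
functionals with summable norms. -/
theorem isNuclear_and_nuclearNorm_le {H : Type*} [NormedAddCommGroup H] [InnerProductSpace ℂ H]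
    {ι : Type*} (e : HilbertBasis ι ℂ H) (Ξ : E →ₗ[ℂ] H) {c : ι → ℝ} (hc0 : ∀ i, 0 ≤ c i)
    (hc : Summable c) (h : ∀ i A, ‖⟪e i, Ξ A⟫_ℂ‖ ≤ c i * ‖A‖) :
    IsNuclear Ξ ∧ nuclearNorm Ξ ≤ ∑' i, c i := by
  let ρ : ι → StrongDual ℂ E := fun i =>
    LinearMap.mkContinuous ((innerₛₗ ℂ (e i)) ∘ₗ Ξ) (c i) (h i)
  have hρ : ∀ i, ‖ρ i‖ * ‖e i‖ ≤ c i := fun i => by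
    rw [e.orthonormal.1, mul_one]
    exact LinearMap.mkContinuous_norm_le _ (hc0 i) _
  have hs : Summable fun i => ‖ρ i‖ * ‖e i‖ := hc.of_nonneg_of_le (fun _ => by positivity) hρ
  have hrep : ∀ A, HasSum (fun i => ρ i A • e i) (Ξ A) := fun A => by
    have := e.hasSum_repr (Ξ A)
    simp only [HilbertBasis.repr_apply_apply] at this
    exact this
  obtain ⟨ρ', Ψ', hrep', hsum⟩ := exists_isNuclearRep ρ e hrep hs
  refine ⟨⟨ρ', Ψ', hrep'⟩, (nuclearNorm_le hrep').trans ?_⟩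
  rw [hsum]
  exact hs.tsum_le_tsum hρ hc

end NuclearRep

/-! ### The operator `T` and its trace -/

section SqrtSumSq

variable {K : Type u} [NormedAddCommGroup K] [InnerProductSpace ℂ K] [CompleteSpace K]

theorem sqrtSumSq_nonneg (T₁ T₂ : K →L[ℂ] K) : 0 ≤ sqrtSumSq T₁ T₂ := CFC.sqrt_nonneg _

theorem sqrtSumSq_mul_self (T₁ T₂ : K →L[ℂ] K) :
    sqrtSumSq T₁ T₂ * sqrtSumSq T₁ T₂
      = CFC.abs T₁ * CFC.abs T₁ + CFC.abs T₂ * CFC.abs T₂ := by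
  have h : 0 ≤ CFC.abs T₁ ^ 2 + CFC.abs T₂ ^ 2 := by
    rw [CFC.abs_sq, CFC.abs_sq]
    exact add_nonneg (star_mul_self_nonneg _) (star_mul_self_nonneg _)
  rw [sqrtSumSq, CFC.sqrt_mul_sqrt_self _ h, pow_two, pow_two]

theorem norm_abs_apply (T : K →L[ℂ] K) (x : K) : ‖CFC.abs T x‖ = ‖T x‖ := by
  have h : ⟪CFC.abs T x, CFC.abs T x⟫_ℂ = ⟪T x, T x⟫_ℂ := by
    rw [← ContinuousLinearMap.adjoint_inner_right,
      (CFC.abs_nonneg T).isSelfAdjoint.adjoint_eq, ← ContinuousLinearMap.adjoint_inner_right T]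
    change ⟪x, (CFC.abs T * CFC.abs T) x⟫_ℂ = ⟪x, (star T * T) x⟫_ℂ
    rw [CFC.abs_mul_abs]
  rw [@norm_eq_sqrt_re_inner ℂ, h, ← @norm_eq_sqrt_re_inner ℂ]

theorem norm_sqrtSumSq_apply_sq (T₁ T₂ : K →L[ℂ] K) (x : K) :
    ‖sqrtSumSq T₁ T₂ x‖ ^ 2 = ‖T₁ x‖ ^ 2 + ‖T₂ x‖ ^ 2 := by
  have h := congrArg Complex.re (inner_map_map_of_mul_self_eq (CFC.abs_nonneg T₁) (CFC.abs_nonneg T₂)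
    (sqrtSumSq_nonneg T₁ T₂) (sqrtSumSq_mul_self T₁ T₂) x x)
  rw [Complex.add_re] at h
  rw [← norm_abs_apply T₁, ← norm_abs_apply T₂, ← inner_self_eq_norm_sq (𝕜 := ℂ),
    ← inner_self_eq_norm_sq (𝕜 := ℂ) (CFC.abs T₁ x),
    ← inner_self_eq_norm_sq (𝕜 := ℂ) (CFC.abs T₂ x)]
  exact h

/-- Source of the constant `2` in the determinant: `(p + q)² ≤ 2(p² + q²)`, and the parallelogram
law gives `p² + q² = 2(‖T₁ x‖² + ‖T₂ x‖²)`. -/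
theorem norm_sub_add_norm_add_le (T₁ T₂ : K →L[ℂ] K) (x : K) :
    ‖T₁ x - T₂ x‖ + ‖T₁ x + T₂ x‖ ≤ 2 * ‖sqrtSumSq T₁ T₂ x‖ := by
  have h1 := norm_sqrtSumSq_apply_sq T₁ T₂ x
  have h2 := parallelogram_law_with_norm ℂ (T₁ x) (T₂ x)
  refine (sq_le_sq₀ (by positivity) (by positivity)).1 ?_
  nlinarith [sq_nonneg (‖T₁ x - T₂ x‖ - ‖T₁ x + T₂ x‖)]

theorem isTraceClass_sqrtSumSq {T₁ T₂ : K →L[ℂ] K} (h₁ : IsTraceClass T₁)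
    (h₂ : IsTraceClass T₂) :
    IsTraceClass (sqrtSumSq T₁ T₂) ∧ ∃ a ≤ traceNorm T₁ + traceNorm T₂,
      HasSum (fun i => (⟪onBasis K i, sqrtSumSq T₁ T₂ (onBasis K i)⟫_ℂ).re) a := by
  have h := summable_trace_and_tsum_le (onBasis K) (CFC.abs_nonneg T₁) (CFC.abs_nonneg T₂)
    (sqrtSumSq_nonneg T₁ T₂) (sqrtSumSq_mul_self T₁ T₂) h₁ h₂
  refine ⟨?_, _, h.2, h.1.hasSum⟩
  rw [IsTraceClass, CFC.abs_of_nonneg _ (sqrtSumSq_nonneg T₁ T₂)]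
  exact h.1

end SqrtSumSq

end FermiFock

end

/-! ### The nuclearity bound -/

theorem proposition2p2 {K : Type*} [NormedAddCommGroup K] [InnerProductSpace ℂ K] [CompleteSpace K]
    (Γ : K →ₗ⋆[ℂ] K) (hΓ : FermiFock.IsAntilinearInvolution Γ)
    (Lφ Lπ : ClosedSubmodule ℂ K)
    (hLφ : ∀ ψ ∈ Lφ, Γ ψ ∈ Lφ) (hLπ : ∀ ψ ∈ Lπ, Γ ψ ∈ Lπ)
    (X : K →ₗ.[ℂ] K) (hX : FermiFock.IsStrictlyPositiveOp X)
    (hXΓ : FermiFock.CommutesWith X Γ)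
    (hdom : ∀ A ∈ FermiFock.fieldAlgebra (FermiFock.realSubspace Γ Lφ.toSubmodule Lπ.toSubmodule),
      A (FermiFock.vacuum K) ∈ (FermiFock.secondQuantization X).domain)
    (Tφ Tπ : K →L[ℂ] K)
    (hTφ : ∀ ψ : X.domain, Tφ ψ = Lφ.toSubmodule.starProjection (X ψ))
    (hTπ : ∀ ψ : X.domain, Tπ ψ = Lπ.toSubmodule.starProjection (X ψ))
    (hTφ_tc : FermiFock.IsTraceClass Tφ) (hTπ_tc : FermiFock.IsTraceClass Tπ) :
    FermiFock.IsNuclear (FermiFock.nuclearityMap X _ hdom) ∧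
    FermiFock.IsTraceClass (FermiFock.sqrtSumSq Tφ Tπ) ∧
    FermiFock.nuclearNorm (FermiFock.nuclearityMap X _ hdom)
      ≤ FermiFock.detOneAdd ((2 : ℂ) • FermiFock.sqrtSumSq Tφ Tπ) ∧
    FermiFock.detOneAdd ((2 : ℂ) • FermiFock.sqrtSumSq Tφ Tπ)
      ≤ Real.exp (2 * FermiFock.traceNorm Tφ) * Real.exp (2 * FermiFock.traceNorm Tπ) := by
  obtain ⟨htc, a, ha, hasum⟩ := FermiFock.isTraceClass_sqrtSumSq hTφ_tc hTπ_tc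
  have hpos : 0 ≤ (2 : ℂ) • FermiFock.sqrtSumSq Tφ Tπ := by
    rw [two_smul]
    exact add_nonneg (FermiFock.sqrtSumSq_nonneg _ _) (FermiFock.sqrtSumSq_nonneg _ _)
  have hasum2 : HasSum (fun i => (⟪FermiFock.onBasis K i,
      ((2 : ℂ) • FermiFock.sqrtSumSq Tφ Tπ) (FermiFock.onBasis K i)⟫_ℂ).re) (2 * a) := by
    refine (hasum.mul_left 2).congr_fun fun i => ?_
    rw [smul_apply, inner_smul_right, Complex.mul_re]
    simp
  obtain ⟨J, b, σ, hσ, hb, hσsum, hdet⟩ :=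
    FermiFock.exists_eigenbasis_detOneAdd hpos (FermiFock.onBasis K) hasum2
  have hbound : ∀ j, ‖Tφ (b j) - Tπ (b j)‖ + ‖Tφ (b j) + Tπ (b j)‖ ≤ σ j := by
    intro j
    refine (FermiFock.norm_sub_add_norm_add_le Tφ Tπ (b j)).trans (le_of_eq ?_)
    have h := congrArg norm (hb j)
    rw [smul_apply, norm_smul, norm_smul, b.orthonormal.1, mul_one, Complex.norm_real,
      Real.norm_of_nonneg (hσ j)] at h
    simpa using h
  -- The products over finite sets of modes are the coefficient bounds in `fockBasis b`; they sum to
  -- `∏ j, (1 + σ j)`.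
  have hprod := summable_finsetProd_of_summable_nonneg hσ hσsum.summable
  have hnuc := FermiFock.isNuclear_and_nuclearNorm_le (FermiFock.fockBasis b)
    (FermiFock.nuclearityMap X _ hdom) (fun s => Finset.prod_nonneg fun j _ => hσ j) hprod
    fun s A => by
      rw [FermiFock.fockBasis_apply]
      refine (FermiFock.norm_inner_wedge_nuclearityMap_le hΓ hLφ hLπ hX hdom hTφ hTπ _ A).trans ?_
      gcongr
      rw [List.map_map, Finset.prod_map_toList]
      exact Finset.prod_le_prod (fun j _ => by simp only [Function.comp_apply]; positivity)
        fun j _ => hbound j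
  refine ⟨hnuc.1, htc, ?_, ?_⟩
  · rw [hdet, tprod_one_add hprod]
    exact hnuc.2
  · rw [hdet, ← Real.exp_add]
    refine (FermiFock.tprod_one_add_le_exp hσ hσsum).trans (Real.exp_le_exp.2 ?_)
    linarith
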